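/- **Setting.** Let $(\Omega,\nu)$ be an atomless standard Borel probability space. A graphon is a symmetric measurable function $W:\Omega^2\to[0,1]$; its minimum degree is $\delta(W)=\operatorname{ess\,inf}_{s}\int_\Omega W(s,t)\,d\nu(t)$. Let $H$ be a finite graph with $v(H)=h$ vertices and chromatic number $\chi(H)$. For $\chi(H)\ge 2$, let $\ell$ be the order of the smallest possible colour class in a proper colouring of $H$ with $\chi(H)$ colours; the critical chromatic number of $H$ is $\chi_{\mathrm{cr}}(H)=\frac{(\chi(H)-1)h}{h-\ell}$. A fractional $H$-cover of $W$ is a measurable function $\mathfrak c:\Omega\to[0,1]$ such that $\sum_{v\in V(H)}\mathfrak c(s_v)\ge 1$ for $\nu^{V(H)}$-almost every $(s_v)_{v\in V(H)}$ with $\prod_{uv\in E(H)}W(s_u,s_v)\ne 0$. Its size is $\int_\Omega\mathfrak c\,d\nu$, and $\mathsf{fcov}(H,W)$ is the infimum of the sizes of all fractional $H$-covers of $W$. For $x\in[0,1)$ and $\chi_{\mathrm{cr}}\in(1,\infty)$, put $r=\lceil\chi_{\mathrm{cr}}\rceil$. A graphon $W$ is a *bottleneck graphon with parameters $x$ and $\chi_{\mathrm{cr}}$*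 if there is a partition $\Omega=\Omega_1\sqcup\dots\sqcup\Omega_r$ into measurable sets such that $$\nu(\Omega_r)=\frac{x(\chi_{\mathrm{cr}}+1-r)}{\chi_{\mathrm{cr}}},\qquad \nu(\Omega_1)=\dots=\nu(\Omega_{r-1})=\frac{\chi_{\mathrm{cr}}-x(\chi_{\mathrm{cr}}+1-r)}{\chi_{\mathrm{cr}}\,(r-1)},$$ $W=1$ almost everywhere on $\Omega_i\times\Omega_j$ for all $1\le i<j\le r$, and $W=0$ almost everywhere on $\Omega_i\times\Omega_i$ for all $1\le i\le r-1$. **Theorem 4.3.** Let $H$ be a finite graph with $\chi(H)\ge 2$, let $x\in[0,1]$, and let $W$ be a graphon with $$\delta(W)\ \ge\ x\left(1-\frac1{\chi_{\mathrm{cr}}(H)}\right)+(1-x)\left(1-\frac1{\chi(H)-1}\right).$$ Then every fractional $H$-cover of $W$ has size at least $\frac{x}{v(H)}$, and hence $\mathsf{fcov}(H,W)\ge\frac{x}{v(H)}$. Furthermore, if $x<1$ and $\mathsf{fcov}(H,W)=\frac{x}{v(H)}$, then $W$ is a bottleneck graphon with parameters $x$ and $\chi_{\mathrm{cr}}(H)$.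 -/

import Mathlib

open MeasureTheory

/-- A graphon on the probability space `(Ω, ν)`: a symmetric function `W : Ω × Ω → [0,1]`, measurable
for the completion of the product measure `ν × ν` (every Borel measurable `W` is allowed). -/
structure Graphon {Ω : Type*} [MeasurableSpace Ω] (ν : Measure Ω) where
  /-- the underlying function of two variables -/
  toFun : Ω → Ω → ℝ
  aemeasurable' : AEMeasurable (fun p : Ω × Ω => toFun p.1 p.2) (ν.prod ν)
  symm' : ∀ s t, toFun s t = toFun t s
  nonneg' : ∀ s t, 0 ≤ toFun s t
  le_one' : ∀ s t, toFun s t ≤ 1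

namespace Graphon

variable {Ω : Type*} [MeasurableSpace Ω] {ν : Measure Ω}

instance : CoeFun (Graphon ν) (fun _ => Ω → Ω → ℝ) := ⟨Graphon.toFun⟩

/-- The degree of a point, `deg_W(s) = ∫ W(s, t) dν(t)`. -/
noncomputable def degree (W : Graphon ν) (s : Ω) : ℝ := ∫ t, W s t ∂ν

/-- The minimum degree `δ(W)`, the essential infimum of the degrees. -/
noncomputable def minDegree (W : Graphon ν) : ℝ := essInf W.degree ν

open Classical in
/-- `W^{⊗F}(s) = ∏_{ab ∈ E(F)} W(s_a, s_b)` for a tuple `s` of points indexed by the vertices of `F`. -/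
noncomputable def tensor {V : Type*} [Fintype V] (W : Graphon ν) (F : SimpleGraph V)
    (s : V → Ω) : ℝ :=
  ∏ e ∈ F.edgeFinset, Sym2.lift ⟨fun a b => W (s a) (s b), fun a b => W.symm' (s a) (s b)⟩ e

/-- `c : Ω → [0,1]` is a fractional `F`-cover of `W`: for almost every tuple in the support of
`W^{⊗F}`, the values of `c` on the tuple sum to at least `1`. -/
structure IsFractionalCover {V : Type*} [Fintype V] (W : Graphon ν) (F : SimpleGraph V)
    (c : Ω → ℝ) : Prop where
  aemeasurable : AEMeasurable c ν
  nonneg : ∀ s, 0 ≤ c s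
  le_one : ∀ s, c s ≤ 1
  cover : Measure.pi (fun _ : V => ν)
    (Function.support (W.tensor F) ∩ {s : V → Ω | ∑ v, c (s v) < 1}) = 0

/-- The fractional `F`-cover number: the infimum of the sizes `∫ c` of fractional `F`-covers. The sizes
are nonnegative, and `c = 1` is a cover as soon as `F` has a vertex. -/
noncomputable def fcov {V : Type*} [Fintype V] (F : SimpleGraph V) (W : Graphon ν) : ℝ :=
  sInf {a : ℝ | ∃ c : Ω → ℝ, W.IsFractionalCover F c ∧ a = ∫ s, c s ∂ν}

/-- `W` is a bottleneck graphon with parameters `x ∈ [0,1)` and `χ > 1`. With `r = ⌈χ⌉`, the space is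
partitioned into `r` measurable classes; the last one has measure `x (χ + 1 - r) / χ`, the other
`r - 1` ones share the rest equally; `W` is `1` almost everywhere between two distinct classes and `0`
almost everywhere inside each class other than the last one. -/
def IsBottleneck (W : Graphon ν) (x χ : ℝ) : Prop :=
  ∃ P : Fin ⌈χ⌉₊ → Set Ω,
    (∀ i, MeasurableSet (P i)) ∧
    Pairwise (fun i j => Disjoint (P i) (P j)) ∧
    (⋃ i, P i) = Set.univ ∧
    (∀ i, i.val + 1 = ⌈χ⌉₊ → ν.real (P i) = x * (χ + 1 - ⌈χ⌉₊) / χ) ∧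
    (∀ i, i.val + 1 < ⌈χ⌉₊ →
      ν.real (P i) = (χ - x * (χ + 1 - ⌈χ⌉₊)) / (χ * ((⌈χ⌉₊ : ℝ) - 1))) ∧
    (∀ i j, i < j → ∀ᵐ p ∂(ν.prod ν), p.1 ∈ P i → p.2 ∈ P j → W p.1 p.2 = 1) ∧
    (∀ i, i.val + 1 < ⌈χ⌉₊ → ∀ᵐ p ∂(ν.prod ν), p.1 ∈ P i → p.2 ∈ P i → W p.1 p.2 = 0)

end Graphon

/-- The chromatic number of a finite graph, as a natural number. -/
noncomputable def finChromaticNumber {V : Type*} [Fintype V] (H : SimpleGraph V) : ℕ :=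
  H.chromaticNumber.toNat

/-- The order of the smallest possible colour class in any proper colouring of `H` with `χ(H)`
colours. -/
noncomputable def smallestColorClass {V : Type*} [Fintype V] (H : SimpleGraph V) : ℕ :=
  sInf {m : ℕ | ∃ (C : H.Coloring (Fin (finChromaticNumber H))) (i : Fin (finChromaticNumber H)),
    m = (C.colorClass i).ncard}

/-- The critical chromatic number `χ_cr(H) = (χ(H) - 1) h / (h - ℓ)`, where `h` is the order of `H` and
`ℓ` the order of the smallest possible colour class in a `χ(H)`-colouring. -/
noncomputable def criticalChromaticNumber {V : Type*} [Fintype V] (H : SimpleGraph V) : ℝ :=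
  ((finChromaticNumber H : ℝ) - 1) * (Fintype.card V : ℝ)
    / ((Fintype.card V : ℝ) - (smallestColorClass H : ℝ))

/-! ### Greedy lower bound for clique covers and its tight case -/

section Greedy

variable {Ω : Type*} [MeasurableSpace Ω] {ν : Measure Ω}

/-! Put n = χ(H) - 1, h = v(H), l = ℓ, k = (h - ℓ)/n, r = x/h and d = x/χ_cr + (1 - x)/n. The degree
hypothesis says that almost every point has non-neighbours of measure at most d. The constants
satisfy n d + r l = 1 and r k = x/χ_cr ≤ d, strictly when x < 1.

A fractional H-cover c also constrains cliques. Almost every (n+1)-clique can be blown up along a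
colouring of H (`ae_notMem_of_ae_not_sections`). Averaging over cyclic shifts of the colours other
than a smallest class then gives weight k to n points and weight l to the last one, with weighted
sum at least 1 (`IsFractionalCover.greedyCover`).

The bound ∫ c ≥ r is greedy (`GreedyCover.le_setIntegral`): take a point where c is nearly its
essential infimum a, subtract a from c, pass to the neighbourhood, losing measure at most d, and
induct. The net gain a(n+1)(d - r k) is nonnegative.

For equality with x < 1, the strict inequality leaves room to perturb r. This forces c to vanish on
a set of positive measure (`GreedyCover.measure_zero_set_ne_zero`). The non-neighbours of a suitable
zero of c form an independent class of measure exactly d, completely joined to the rest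
(`GreedyCover.exists_isFullClass`). Removing it preserves tightness with n lowered by one, so
iteration yields n classes and a remainder of measure r l. The argument is run on an optimal cover,
which exists by an L² compactness argument (`exists_isFractionalCover_integral_eq_fcov`). -/

/-- Choosing `n + 1` points of `S` one after another, each in the neighbourhoods `N` of the previous
ones, gives almost surely a weighted sum of values of `c` of at least `β`, where the first `n` points
have weight `k` and the last one has weight `l`. -/
def GreedyCover (ν : Measure Ω) (N : Ω → Set Ω) (k l : ℝ) (c : Ω → ℝ) : ℕ → Set Ω → ℝ → Prop
  | 0, S, β => ∀ᵐ t ∂ν, t ∈ S → β ≤ l * c t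
  | n + 1, S, β => ∀ᵐ t ∂ν, t ∈ S → GreedyCover ν N k l c n (S ∩ N t) (β - k * c t)

theorem GreedyCover.mono {N : Ω → Set Ω} {k l : ℝ} {c : Ω → ℝ} {n : ℕ} {S : Set Ω} {β β' : ℝ}
    (h : GreedyCover ν N k l c n S β) (hβ : β' ≤ β) : GreedyCover ν N k l c n S β' := by
  induction n generalizing S β β' with
  | zero => exact Filter.Eventually.mono h fun t ht hS => hβ.trans (ht hS)
  | succ n ih => exact Filter.Eventually.mono h fun t ht hS => ih (ht hS) (by linarith)

/-- The weights of the n + 1 chosen points add up to n k + l. -/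
theorem GreedyCover.sub_const {N : Ω → Set Ω} {k l : ℝ} {c : Ω → ℝ} {n : ℕ} {S : Set Ω} {β : ℝ}
    (h : GreedyCover ν N k l c n S β) (a : ℝ) :
    GreedyCover ν N k l (fun t => c t - a) n S (β - (n * k + l) * a) := by
  induction n generalizing S β with
  | zero =>
    refine Filter.Eventually.mono h fun t ht hS => ?_
    have := ht hS
    push_cast
    linarith
  | succ n ih =>
    refine Filter.Eventually.mono h fun t ht hS => (ih (ht hS)).mono (le_of_eq ?_)
    push_cast
    ring

theorem exists_essential_lower_bound {S : Set Ω} (hS : ν S ≠ 0) {c : Ω → ℝ}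
    (hc : ∀ᵐ t ∂ν, t ∈ S → 0 ≤ c t) :
    ∃ a, 0 ≤ a ∧ (∀ᵐ t ∂ν, t ∈ S → a ≤ c t) ∧ ∀ ε > 0, ∃ᶠ t in ae ν, t ∈ S ∧ c t < a + ε := by
  set A : Set ℝ := {a | ∀ᵐ t ∂ν, t ∈ S → a ≤ c t} with hA
  have h0 : (0 : ℝ) ∈ A := hc
  have hbdd : BddAbove A := by
    by_contra hb
    have hall : ∀ m : ℕ, ∀ᵐ t ∂ν, t ∈ S → (m : ℝ) ≤ c t := by
      intro m
      obtain ⟨a, ha, hma⟩ := not_bddAbove_iff.1 hb m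
      exact Filter.Eventually.mono ha fun t ht hS => hma.le.trans (ht hS)
    refine hS (measure_eq_zero_iff_ae_notMem.2 ?_)
    filter_upwards [ae_all_iff.2 hall] with t ht hS
    obtain ⟨m, hm⟩ := exists_nat_gt (c t)
    exact absurd (ht m hS) (not_le.2 hm)
  refine ⟨sSup A, le_csSup hbdd h0, ?_, ?_⟩
  · have hall : ∀ m : ℕ, ∀ᵐ t ∂ν, t ∈ S → sSup A - 1 / ((m : ℝ) + 1) ≤ c t := by
      intro m
      obtain ⟨a, ha, hlt⟩ := exists_lt_of_lt_csSup ⟨0, h0⟩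
        (sub_lt_self (sSup A) (Nat.one_div_pos_of_nat (n := m) (α := ℝ)))
      exact Filter.Eventually.mono ha fun t ht hS => hlt.le.trans (ht hS)
    filter_upwards [ae_all_iff.2 hall] with t ht hS
    refine le_of_forall_pos_le_add fun ε hε => ?_
    obtain ⟨m, hm⟩ := exists_nat_one_div_lt hε
    linarith [ht m hS]
  · intro ε hε hcon
    have : sSup A + ε ∈ A := by
      refine Filter.Eventually.mono hcon fun t ht hS => ?_
      by_contra hlt
      exact ht ⟨hS, not_le.1 hlt⟩
    linarith [le_csSup hbdd this]

theorem measureReal_inter_ge [IsFiniteMeasure ν] {S T : Set Ω} (hT : MeasurableSet T) {d : ℝ}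
    (h : ν.real Tᶜ ≤ d) : ν.real S - d ≤ ν.real (S ∩ T) := by
  have h1 := measureReal_inter_add_sdiff (μ := ν) (s := S) hT
  have h2 : ν.real (S \ T) ≤ ν.real Tᶜ := measureReal_mono fun _ h => h.2
  linarith

/-- Induction on n, subtracting the essential infimum of c at each step. Nonnegativity is asked only
almost everywhere on S because the reduced function may be negative elsewhere; β is free because it
drops along the way. -/
theorem GreedyCover.le_setIntegral [IsProbabilityMeasure ν] {N : Ω → Set Ω}
    (hN : ∀ t, MeasurableSet (N t)) {k l d r : ℝ} (hd : ∀ᵐ t ∂ν, ν.real (N t)ᶜ ≤ d)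
    (hl : 0 < l) (hr : 0 ≤ r) (hrd : r * k ≤ d) (hk : 0 ≤ k) {n : ℕ} {S : Set Ω}
    (hS : MeasurableSet S) {c : Ω → ℝ} (hc : Integrable c ν) (hc0 : ∀ᵐ t ∂ν, t ∈ S → 0 ≤ c t)
    {β : ℝ} (h : GreedyCover ν N k l c n S β) (hν : n * d + r * l ≤ ν.real S) :
    r * β ≤ ∫ t in S, c t ∂ν := by
  have hnn : ∀ {T : Set Ω} {f : Ω → ℝ}, MeasurableSet T → (∀ᵐ t ∂ν, t ∈ T → 0 ≤ f t) →
      0 ≤ ∫ t in T, f t ∂ν := fun hT hf =>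
    integral_nonneg_of_ae ((ae_restrict_iff' hT).2 hf)
  have hconst : ∀ {T : Set Ω} {f : Ω → ℝ} {a : ℝ}, MeasurableSet T → Integrable f ν →
      (∀ᵐ t ∂ν, t ∈ T → a ≤ f t) → a * ν.real T ≤ ∫ t in T, f t ∂ν := by
    intro T f a hT hf hle
    have := setIntegral_mono_on_ae (integrable_const a).integrableOn hf.integrableOn hT hle
    rwa [setIntegral_const, smul_eq_mul, mul_comm] at this
  induction n generalizing S c β with
  | zero =>
    rcases le_or_gt β 0 with hβ | hβ
    · exact (mul_nonpos_of_nonneg_of_nonpos hr hβ).trans (hnn hS hc0)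
    · have h1 : β / l * ν.real S ≤ ∫ t in S, c t ∂ν := by
        refine hconst hS hc (Filter.Eventually.mono h fun t ht hS => ?_)
        rw [div_le_iff₀ hl]
        linarith [ht hS]
      refine le_trans ?_ h1
      rw [div_mul_eq_mul_div, le_div_iff₀ hl]
      push_cast at hν
      nlinarith
  | succ n ih =>
    have hd0 : 0 ≤ d := (mul_nonneg hr hk).trans hrd
    rcases hr.eq_or_lt with rfl | hr
    · simpa using hnn hS hc0
    have hS0 : ν S ≠ 0 := by
      intro h0
      rw [measureReal_def, h0, ENNReal.toReal_zero] at hν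
      have : 0 < r * l := mul_pos hr hl
      have : 0 ≤ ((n + 1 : ℕ) : ℝ) * d := by positivity
      linarith
    obtain ⟨a, ha0, ha, hfreq⟩ := exists_essential_lower_bound hS0 hc0
    refine le_of_forall_pos_le_add fun ε hε => ?_
    have hε' : 0 < ε / (r * k + 1) := by positivity
    obtain ⟨t, ⟨htS, hta⟩, htG, htd⟩ := ((hfreq _ hε').and_eventually (h.and hd)).exists
    have hν' := measureReal_inter_ge (S := S) (hN t) htd
    have hS' : MeasurableSet (S ∩ N t) := hS.inter (hN t)
    push_cast at hν
    have hca : Integrable (fun u => c u - a) ν := hc.sub (integrable_const a)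
    have key := ih hS' hca
      (ha.mono fun u hu huS => sub_nonneg.2 (hu huS.1)) ((htG htS).sub_const a) (by linarith)
    have hsplit : ∫ u in S ∩ N t, (c u - a) ∂ν ≤ ∫ u in S, (c u - a) ∂ν := by
      refine setIntegral_mono_set hca.integrableOn
        ((ae_restrict_iff' hS).2 (ha.mono fun u hu huS => sub_nonneg.2 (hu huS))) ?_
      exact Filter.Eventually.of_forall fun u hu => hu.1
    have hint : ∫ u in S, (c u - a) ∂ν = (∫ u in S, c u ∂ν) - a * ν.real S := by
      rw [integral_sub hc.integrableOn (integrable_const a).integrableOn, setIntegral_const,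
        smul_eq_mul, mul_comm]
    have hε2 : r * k * (ε / (r * k + 1)) ≤ ε := by
      rw [mul_div_assoc', div_le_iff₀ (by positivity)]
      nlinarith [mul_nonneg hr.le hk]
    -- Subtracting a frees a · ν(S) and costs r(k + n k + l)a in the target, up to ε; since ν(S) ≥
    -- (n+1)d + r l, the balance is at least a(n+1)(d - r k) ≥ 0.
    have h3 : r * k * c t ≤ r * k * (a + ε / (r * k + 1)) :=
      mul_le_mul_of_nonneg_left hta.le (by positivity)
    have h4 : a * ((n + 1) * d + r * l) ≤ a * ν.real S := mul_le_mul_of_nonneg_left hν ha0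
    have h5 : 0 ≤ a * ((n + 1) * (d - r * k)) :=
      mul_nonneg ha0 (mul_nonneg (by positivity) (by linarith))
    nlinarith

/-- If S were larger, r could be raised to r + κ without violating r k ≤ d or the size condition,
and the greedy bound would exceed the integral. -/
theorem GreedyCover.measureReal_le [IsProbabilityMeasure ν] {N : Ω → Set Ω}
    (hN : ∀ t, MeasurableSet (N t)) {k l d r : ℝ} (hd : ∀ᵐ t ∂ν, ν.real (N t)ᶜ ≤ d)
    (hl : 0 < l) (hr : 0 ≤ r) (hrd : r * k < d) (hk : 0 < k) {n : ℕ} {S : Set Ω}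
    (hS : MeasurableSet S) {c : Ω → ℝ} (hc : Integrable c ν) (hc0 : ∀ t, 0 ≤ c t)
    (h : GreedyCover ν N k l c n S 1) (hint : ∫ t in S, c t ∂ν ≤ r) :
    ν.real S ≤ n * d + r * l := by
  by_contra! hlt
  set κ := min ((d - r * k) / k) ((ν.real S - (n * d + r * l)) / l) with hκ
  have hκ0 : 0 < κ := lt_min (div_pos (by linarith) hk) (div_pos (by linarith) hl)
  have h1 : κ * k ≤ d - r * k := (le_div_iff₀ hk).1 (min_le_left _ _)
  have h2 : κ * l ≤ ν.real S - (n * d + r * l) := (le_div_iff₀ hl).1 (min_le_right _ _)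
  have := h.le_setIntegral hN hd hl (r := r + κ) (by positivity) (by linarith) hk.le hS hc
    (Filter.Eventually.of_forall fun t _ => hc0 t) (by linarith)
  linarith

theorem exists_pos_measureReal_lt [IsFiniteMeasure ν] {S : Set Ω} (hS : MeasurableSet S)
    {c : Ω → ℝ} (hcm : Measurable c) (hc0 : ∀ t, 0 ≤ c t) (h0 : ν (S ∩ {t | c t = 0}) = 0) {η : ℝ}
    (hη : 0 < η) : ∃ y > 0, ν.real (S ∩ {t | c t < y}) < η := by
  have hanti : Antitone fun m : ℕ => S ∩ {t | c t < 1 / ((m : ℝ) + 1)} := by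
    intro m m' hm t ht
    have h : c t < 1 / ((m' : ℝ) + 1) := ht.2
    exact ⟨ht.1, h.trans_le (Nat.one_div_le_one_div hm)⟩
  have hlim := tendsto_measure_iInter_atTop (μ := ν)
    (fun m : ℕ => (hS.inter (measurableSet_lt hcm (measurable_const (a := 1 / ((m : ℝ) + 1))))).nullMeasurableSet)
    hanti ⟨0, measure_ne_top _ _⟩
  have hint : (⋂ m : ℕ, S ∩ {t | c t < 1 / ((m : ℝ) + 1)}) ⊆ S ∩ {t | c t = 0} := by
    intro t ht
    rw [Set.mem_iInter] at ht
    refine ⟨(ht 0).1, le_antisymm (le_of_forall_pos_le_add fun ε hε => ?_) (hc0 t)⟩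
    obtain ⟨m, hm⟩ := exists_nat_one_div_lt hε
    have : c t < 1 / ((m : ℝ) + 1) := (ht m).2
    linarith
  rw [measure_mono_null hint h0] at hlim
  obtain ⟨m, hm⟩ := (hlim.eventually (gt_mem_nhds (ENNReal.ofReal_pos.2 hη))).exists
  refine ⟨1 / ((m : ℝ) + 1), Nat.one_div_pos_of_nat, ?_⟩
  exact (ENNReal.lt_ofReal_iff_toReal_lt (measure_ne_top _ _)).1 hm

/-- If c were almost everywhere positive on S, it would be at least some y > 0 off a set of measure
below d/2. A point with tiny c then cannot have nearly d of non-neighbours in S, as they would carry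
too much integral. Its neighbourhood in S is thus too large for the greedy bound. -/
theorem GreedyCover.measure_zero_set_ne_zero [IsProbabilityMeasure ν] {N : Ω → Set Ω}
    (hN : ∀ t, MeasurableSet (N t)) {k l d r : ℝ} (hd : ∀ᵐ t ∂ν, ν.real (N t)ᶜ ≤ d)
    (hl : 0 < l) (hr : 0 ≤ r) (hrd : r * k < d) (hk : 0 < k) {n : ℕ} {S : Set Ω}
    (hS : MeasurableSet S) {c : Ω → ℝ} (hcm : Measurable c) (hc : Integrable c ν)
    (hc0 : ∀ t, 0 ≤ c t) (h : GreedyCover ν N k l c (n + 1) S 1) (hint : ∫ t in S, c t ∂ν = r)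
    (hν : ν.real S = (n + 1) * d + r * l) : ν (S ∩ {t | c t = 0}) ≠ 0 := by
  intro hzero
  have hd0 : 0 < d := lt_of_le_of_lt (by positivity) hrd
  have hS0 : ν S ≠ 0 := by
    intro h0
    rw [measureReal_def, h0, ENNReal.toReal_zero] at hν
    have : 0 < (n + 1) * d := by positivity
    have : 0 ≤ r * l := by positivity
    linarith
  obtain ⟨a, ha0, ha, hfreq⟩ :=
    exists_essential_lower_bound hS0 (Filter.Eventually.of_forall fun t _ => hc0 t)
  -- Tightness leaves no room for the gain a(n+1)(d - r k), whose last factor is positive.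
  have haz : a = 0 := by
    have hca : Integrable (fun u => c u - a) ν := hc.sub (integrable_const a)
    have h1 := (h.sub_const a).le_setIntegral hN hd hl hr hrd.le hk.le hS hca (ha.mono fun u hu huS => sub_nonneg.2 (hu huS))
      (by push_cast; linarith)
    rw [integral_sub hc.integrableOn (integrable_const a).integrableOn, setIntegral_const,
        smul_eq_mul, hint, hν] at h1
    push_cast at h1
    have h2 : a * ((n + 1) * (d - r * k)) ≤ 0 := by linarith
    have h3 : 0 < (n + 1) * (d - r * k) := mul_pos (by positivity) (by linarith)
    exact le_antisymm (nonpos_of_mul_nonpos_left h2 h3) ha0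
  subst haz
  obtain ⟨y, hy, hyS⟩ := exists_pos_measureReal_lt hS hcm hc0 hzero (half_pos hd0)
  set κ := min ((d - r * k) / k) (d / 4 / l) with hκ
  have hκ0 : 0 < κ := lt_min (div_pos (by linarith) hk) (by positivity)
  have hκ1 : κ * k ≤ d - r * k := (le_div_iff₀ hk).1 (min_le_left _ _)
  have hκ2 : κ * l ≤ d / 4 := (le_div_iff₀ hl).1 (min_le_right _ _)
  -- The first inequality makes the loss r k ε smaller than the integral forced on the
  -- non-neighbours; the second makes (r + κ)(1 - k ε) exceed r.
  have hsmall : ∃ ε > 0, r * k * ε < y * (d / 4) ∧ (r + κ) * (k * ε) < κ := by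
    have h1 : Filter.Tendsto (fun ε : ℝ => r * k * ε) (nhdsWithin 0 (Set.Ioi 0)) (nhds 0) := by
      have : Continuous fun ε : ℝ => r * k * ε := by fun_prop
      simpa using (this.tendsto 0).mono_left nhdsWithin_le_nhds
    have h2 : Filter.Tendsto (fun ε : ℝ => (r + κ) * (k * ε)) (nhdsWithin 0 (Set.Ioi 0))
        (nhds 0) := by
      have : Continuous fun ε : ℝ => (r + κ) * (k * ε) := by fun_prop
      simpa using (this.tendsto 0).mono_left nhdsWithin_le_nhds
    obtain ⟨ε, ⟨hε1, hε2⟩, hε⟩ := (((h1.eventually (gt_mem_nhds (show 0 < y * (d / 4) by positivity))).and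
      (h2.eventually (gt_mem_nhds hκ0))).and self_mem_nhdsWithin).exists
    exact ⟨ε, hε, hε1, hε2⟩
  obtain ⟨ε, hε, hε1, hε2⟩ := hsmall
  obtain ⟨t, ⟨htS, hta⟩, htG, htd⟩ := ((hfreq ε hε).and_eventually (h.and hd)).exists
  rw [zero_add] at hta
  have hG := (htG htS).mono (β' := 1 - k * ε) (by nlinarith)
  have hν' := measureReal_inter_ge (S := S) (hN t) htd
  have hS' : MeasurableSet (S ∩ N t) := hS.inter (hN t)
  have hnn : ∀ᵐ u ∂ν, u ∈ S ∩ N t → 0 ≤ c u := Filter.Eventually.of_forall fun u _ => hc0 u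
  have hsum := integral_inter_add_sdiff (μ := ν) (f := c) (hN t) (hc.integrableOn (s := S))
  have hdiff0 : 0 ≤ ∫ u in S \ N t, c u ∂ν := integral_nonneg hc0
  have hI := hG.le_setIntegral hN hd hl hr hrd.le hk.le hS' hc hnn (by linarith)
  have hmeas := measureReal_inter_add_sdiff (μ := ν) (s := S) (hN t)
  have hD : y * (ν.real (S \ N t) - d / 2) ≤ ∫ u in S \ N t, c u ∂ν := by
    set E := (S \ N t) ∩ {u | y ≤ c u} with hE
    have hEm : MeasurableSet E := (hS.diff (hN t)).inter (measurableSet_le measurable_const hcm)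
    have h1 : ν.real (S \ N t) - d / 2 ≤ ν.real E := by
      have hsub : S \ N t ⊆ E ∪ (S ∩ {u | c u < y}) := by
        intro u hu
        rcases le_or_gt y (c u) with h | h
        · exact Or.inl ⟨hu, h⟩
        · exact Or.inr ⟨hu.1, h⟩
      have := (measureReal_mono (μ := ν) hsub).trans (measureReal_union_le _ _)
      linarith
    have h2 : y * ν.real E ≤ ∫ u in E, c u ∂ν := by
      have := setIntegral_mono_on (integrable_const y).integrableOn hc.integrableOn hEm
        (μ := ν) (fun u hu => hu.2)
      rwa [setIntegral_const, smul_eq_mul, mul_comm] at this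
    have h3 : ∫ u in E, c u ∂ν ≤ ∫ u in S \ N t, c u ∂ν :=
      setIntegral_mono_set hc.integrableOn (Filter.Eventually.of_forall fun u => hc0 u)
        (Filter.Eventually.of_forall fun u hu => hu.1)
    nlinarith
  have hslack : d / 4 ≤ d - ν.real (S \ N t) := by
    by_contra! hlt
    have : y * (d / 4) < y * (ν.real (S \ N t) - d / 2) := mul_lt_mul_of_pos_left (by linarith) hy
    nlinarith
  have hfin := hG.le_setIntegral hN hd hl (r := r + κ) (by positivity) (by linarith) hk.le hS' hc hnn
    (by linarith)
  nlinarith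

end Greedy

/-! ### Extracting the independent classes from a tight cover -/

section Extremal

variable {Ω : Type*} [MeasurableSpace Ω] {ν : Measure Ω}

/-- Fubini; it allows one s to be fixed for which a property of almost all triples holds for almost
all t, t'. -/
theorem ae_ae_ae_rotate [SFinite ν] {p : Ω → Ω → Ω → Prop}
    (hp : MeasurableSet {x : (Ω × Ω) × Ω | p x.1.1 x.1.2 x.2})
    (h : ∀ᵐ t ∂ν, ∀ᵐ t' ∂ν, ∀ᵐ s ∂ν, p t t' s) : ∀ᵐ s ∂ν, ∀ᵐ t ∂ν, ∀ᵐ t' ∂ν, p t t' s := by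
  have hm : MeasurableSet {q : Ω × Ω | ∀ᵐ s ∂ν, p q.1 q.2 s} :=
    (measurable_measure_prodMk_left hp.compl) (measurableSet_singleton 0)
  have h1 : ∀ᵐ q ∂ν.prod ν, ∀ᵐ s ∂ν, p q.1 q.2 s := (Measure.ae_prod_iff_ae_ae hm).2 h
  have h2 := (Measure.ae_ae_comm (p := fun (q : Ω × Ω) s => p q.1 q.2 s) hp).1 h1
  exact h2.mono fun s hs => Measure.ae_ae_of_ae_prod hs

/-- The points `u` with `W t u > 0`. -/
def posNbhd (W : Ω → Ω → ℝ) (t : Ω) : Set Ω := {u | 0 < W t u}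

theorem measurableSet_posNbhd {W : Ω → Ω → ℝ} (hW : Measurable (Function.uncurry W)) (t : Ω) :
    MeasurableSet (posNbhd W t) :=
  measurableSet_lt measurable_const (hW.comp measurable_prodMk_left)

theorem integrable_of_mem_unit [IsFiniteMeasure ν] {f : Ω → ℝ} (hf : Measurable f)
    (h0 : ∀ t, 0 ≤ f t) (h1 : ∀ t, f t ≤ 1) : Integrable f ν :=
  Integrable.of_bound hf.aestronglyMeasurable 1 (Filter.Eventually.of_forall fun t => by
    rw [Real.norm_eq_abs, abs_of_nonneg (h0 t)]; exact h1 t)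

theorem indicator_posNbhd_ge {Ω : Type*} {W : Ω → Ω → ℝ} (hW1 : ∀ s t, W s t ≤ 1) (t u : Ω) :
    W t u ≤ (posNbhd W t).indicator (fun _ => (1 : ℝ)) u := by
  by_cases h : u ∈ posNbhd W t
  · rw [Set.indicator_of_mem h]; exact hW1 t u
  · rw [Set.indicator_of_notMem h]; exact not_lt.1 h

variable [IsProbabilityMeasure ν] {W : Ω → Ω → ℝ}

theorem measureReal_compl_posNbhd_le (hW : Measurable (Function.uncurry W))
    (hW0 : ∀ s t, 0 ≤ W s t) (hW1 : ∀ s t, W s t ≤ 1) {d : ℝ} {t : Ω}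
    (ht : 1 - d ≤ ∫ u, W t u ∂ν) : ν.real (posNbhd W t)ᶜ ≤ d := by
  have hm := measurableSet_posNbhd hW t
  have h1 : ∫ u, W t u ∂ν ≤ ∫ u, (posNbhd W t).indicator (fun _ => (1 : ℝ)) u ∂ν :=
    integral_mono (integrable_of_mem_unit (hW.comp measurable_prodMk_left) (hW0 t) (hW1 t))
      ((integrable_const 1).indicator hm) (indicator_posNbhd_ge hW1 t)
  rw [integral_indicator hm, setIntegral_const, smul_eq_mul, mul_one] at h1
  rw [probReal_compl_eq_one_sub hm]
  linarith

/-- W(t, ·) lies below the indicator of a set of measure 1 - d, yet has integral at least 1 - d. -/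
theorem ae_eq_one_of_measureReal_compl_eq (hW : Measurable (Function.uncurry W))
    (hW0 : ∀ s t, 0 ≤ W s t) (hW1 : ∀ s t, W s t ≤ 1) {d : ℝ} {t : Ω}
    (ht : 1 - d ≤ ∫ u, W t u ∂ν) (hd : ν.real (posNbhd W t)ᶜ = d) :
    ∀ᵐ u ∂ν, u ∈ posNbhd W t → W t u = 1 := by
  have hm := measurableSet_posNbhd hW t
  have hint : Integrable (fun u => W t u) ν :=
    integrable_of_mem_unit (hW.comp measurable_prodMk_left) (hW0 t) (hW1 t)
  have hind : Integrable ((posNbhd W t).indicator fun _ => (1 : ℝ)) ν :=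
    (integrable_const 1).indicator hm
  have heq : ∫ u, W t u ∂ν = ∫ u, (posNbhd W t).indicator (fun _ => (1 : ℝ)) u ∂ν := by
    refine le_antisymm (integral_mono hint hind (indicator_posNbhd_ge hW1 t)) ?_
    rw [integral_indicator hm, setIntegral_const, smul_eq_mul, mul_one]
    rw [probReal_compl_eq_one_sub hm] at hd
    linarith
  have := (integral_eq_iff_of_ae_le hint hind
    (Filter.Eventually.of_forall (indicator_posNbhd_ge hW1 t))).1 heq
  filter_upwards [this] with u hu hmem
  rw [hu, Set.indicator_of_mem hmem]

/-- `P` is an independent class of a weighted complete multipartite structure: `W` vanishes inside `P`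
and equals `1` between `P` and its complement. -/
structure IsFullClass (ν : Measure Ω) (W : Ω → Ω → ℝ) (d : ℝ) (P : Set Ω) : Prop where
  measurableSet : MeasurableSet P
  measureReal_eq : ν.real P = d
  ae_zero : ∀ᵐ p ∂ν.prod ν, p.1 ∈ P → p.2 ∈ P → W p.1 p.2 = 0
  ae_one : ∀ᵐ p ∂ν.prod ν, p.1 ∈ P → p.2 ∉ P → W p.1 p.2 = 1

/-- A zero of c costs nothing in the greedy process, so its neighbourhood in S still carries a cover
with target 1. Tightness then determines the measure, the integral and the values of W around it. -/
theorem GreedyCover.exists_isFullClass (hW : Measurable (Function.uncurry W))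
    (hW0 : ∀ s t, 0 ≤ W s t) (hW1 : ∀ s t, W s t ≤ 1) (hsymm : ∀ s t, W s t = W t s)
    {k l d r : ℝ} (hdeg : ∀ᵐ t ∂ν, 1 - d ≤ ∫ u, W t u ∂ν)
    (hl : 0 < l) (hr : 0 ≤ r) (hrd : r * k < d) (hk : 0 < k) {n : ℕ} {S : Set Ω}
    (hS : MeasurableSet S) {c : Ω → ℝ} (hcm : Measurable c) (hc : Integrable c ν)
    (hc0 : ∀ t, 0 ≤ c t) (h : GreedyCover ν (posNbhd W) k l c (n + 1) S 1)
    (hint : ∫ t in S, c t ∂ν = r) (hν : ν.real S = (n + 1) * d + r * l) :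
    ∃ P ⊆ S, IsFullClass ν W d P ∧ GreedyCover ν (posNbhd W) k l c n (S \ P) 1 ∧
      ∫ t in S \ P, c t ∂ν = r := by
  have hN : ∀ t, MeasurableSet (posNbhd W t) := measurableSet_posNbhd hW
  have hd : ∀ᵐ t ∂ν, ν.real (posNbhd W t)ᶜ ≤ d :=
    hdeg.mono fun t ht => measureReal_compl_posNbhd_le hW hW0 hW1 ht
  set Z : Set Ω := S ∩ {t | c t = 0} with hZ
  have hZm : MeasurableSet Z := hS.inter (hcm (measurableSet_singleton 0))
  have hZ0 : ν Z ≠ 0 :=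
    h.measure_zero_set_ne_zero hN hd hl hr hrd hk hS hcm hc hc0 hint hν
  have hle : ∀ {T : Set Ω}, T ⊆ S → ∫ t in T, c t ∂ν ≤ r := by
    intro T hT
    rw [← hint]
    exact setIntegral_mono_set hc.integrableOn (Filter.Eventually.of_forall hc0)
      (Filter.Eventually.of_forall hT)
  have hZG : ∀ᵐ t ∂ν, t ∈ Z → GreedyCover ν (posNbhd W) k l c n (S ∩ posNbhd W t) 1 :=
    Filter.Eventually.mono h fun t ht hmem => (ht hmem.1).mono (by
      have : c t = 0 := hmem.2
      rw [this]; linarith)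
  -- `GreedyCover.measureReal_le` caps the measure of S ∩ N(t) at n d + r l, while removing at most
  -- d from S leaves at least that much; hence every inequality is an equality.
  have hgood : ∀ᵐ t ∂ν, t ∈ Z → ν.real (posNbhd W t)ᶜ = d ∧ ν.real (S \ posNbhd W t) = d ∧
      (∀ᵐ u ∂ν, u ∈ S \ posNbhd W t → c u = 0) ∧ ∫ u in S ∩ posNbhd W t, c u ∂ν = r ∧
      ∀ᵐ u ∂ν, u ∈ posNbhd W t → W t u = 1 := by
    filter_upwards [hZG, hd, hdeg] with t htG htd htdeg hmem
    have hSm : MeasurableSet (S ∩ posNbhd W t) := hS.inter (hN t)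
    have h1 := (htG hmem).measureReal_le hN hd hl hr hrd hk hSm hc hc0
      (hle Set.inter_subset_left)
    have h2 := measureReal_inter_ge (S := S) (hN t) htd
    have h3 := measureReal_inter_add_sdiff (μ := ν) (s := S) (hN t)
    have h4 : ν.real (S \ posNbhd W t) ≤ ν.real (posNbhd W t)ᶜ := measureReal_mono fun _ h => h.2
    have h5 := (htG hmem).le_setIntegral hN hd hl hr hrd.le hk.le hSm hc
      (Filter.Eventually.of_forall fun u _ => hc0 u) (by linarith)
    have h6 : ∫ u in S ∩ posNbhd W t, c u ∂ν = r :=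
      le_antisymm (hle Set.inter_subset_left) (by linarith)
    have h7 := integral_inter_add_sdiff (μ := ν) (f := c) (hN t) (hc.integrableOn (s := S))
    have h8 : ν.real (posNbhd W t)ᶜ = d := by linarith
    refine ⟨h8, by linarith, ?_, h6, ae_eq_one_of_measureReal_compl_eq hW hW0 hW1 htdeg h8⟩
    have h9 : ∫ u in S \ posNbhd W t, c u ∂ν = 0 := by linarith
    exact (ae_restrict_iff' (hS.diff (hN t))).1
      ((integral_eq_zero_iff_of_nonneg (fun u => hc0 u) hc.integrableOn).1 h9)
  -- After two adjacent zeros, the cap lowers the measure by 2d, so their non-neighbourhoods, each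
  -- of measure at most d, are almost disjoint. With n = 0 two adjacent zeros contradict the cover
  -- directly.
  have hadj : ∀ᵐ t ∂ν, t ∈ Z → ∀ᵐ t' ∂ν, t' ∈ Z → t' ∈ posNbhd W t →
      ν ((posNbhd W t)ᶜ ∩ (posNbhd W t')ᶜ) = 0 := by
    filter_upwards [hZG, hd] with t htG htd hmem
    cases n with
    | zero =>
      refine Filter.Eventually.mono (htG hmem) fun t' ht' hmem' hadj => ?_
      have h1 := ht' ⟨hmem'.1, hadj⟩
      have h2 : c t' = 0 := hmem'.2
      rw [h2] at h1
      linarith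
    | succ m =>
      filter_upwards [htG hmem, hd] with t' htG' htd' hmem' hadj
      have h2 : c t' = 0 := hmem'.2
      have hG := (htG' ⟨hmem'.1, hadj⟩).mono (β' := 1) (by rw [h2]; linarith)
      have hTm : MeasurableSet (S ∩ posNbhd W t ∩ posNbhd W t') := (hS.inter (hN t)).inter (hN t')
      have h1 := hG.measureReal_le hN hd hl hr hrd hk hTm hc hc0
        (hle (Set.inter_subset_left.trans Set.inter_subset_left))
      have hsub : S ⊆ (S ∩ posNbhd W t ∩ posNbhd W t') ∪ ((posNbhd W t)ᶜ ∪ (posNbhd W t')ᶜ) := by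
        intro u hu
        by_cases h1 : u ∈ posNbhd W t <;> by_cases h2 : u ∈ posNbhd W t' <;> simp [h1, h2, hu]
      have h3 := (measureReal_mono (μ := ν) hsub).trans (measureReal_union_le _ _)
      have h4 := measureReal_union_add_inter (μ := ν) (s := (posNbhd W t)ᶜ) (hN t').compl
      push_cast at hν
      have h5 : ν.real ((posNbhd W t)ᶜ ∩ (posNbhd W t')ᶜ) = 0 :=
        le_antisymm (by linarith) measureReal_nonneg
      exact (measureReal_eq_zero_iff).1 h5
  have htriple : ∀ᵐ s ∂ν, ∀ᵐ t ∂ν, ∀ᵐ t' ∂ν,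
      ¬ (t ∈ Z ∧ t' ∈ Z ∧ 0 < W t t' ∧ W t s ≤ 0 ∧ W t' s ≤ 0) := by
    refine ae_ae_ae_rotate ?_ ?_
    · have hW' : ∀ {f g : (Ω × Ω) × Ω → Ω}, Measurable f → Measurable g →
          Measurable fun x => W (f x) (g x) := fun hf hg => hW.comp (hf.prodMk hg)
      have e1 : Measurable fun x : (Ω × Ω) × Ω => x.1.1 := measurable_fst.comp measurable_fst
      have e2 : Measurable fun x : (Ω × Ω) × Ω => x.1.2 := measurable_snd.comp measurable_fst
      refine MeasurableSet.compl ((e1 hZm).inter ((e2 hZm).inter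
        ((measurableSet_lt measurable_const (hW' e1 e2)).inter
        ((measurableSet_le (hW' e1 measurable_snd) measurable_const).inter
        (measurableSet_le (hW' e2 measurable_snd) measurable_const)))))
    · filter_upwards [hadj] with t ht
      by_cases hmem : t ∈ Z
      · filter_upwards [ht hmem] with t' ht'
        by_cases hmem' : t' ∈ Z ∧ 0 < W t t'
        · filter_upwards [measure_eq_zero_iff_ae_notMem.1 (ht' hmem'.1 hmem'.2)] with s hs hcon
          exact hs ⟨not_lt.2 hcon.2.2.2.1, not_lt.2 hcon.2.2.2.2⟩
        · exact Filter.Eventually.of_forall fun s hcon => hmem' ⟨hcon.2.1, hcon.2.2.1⟩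
      · exact Filter.Eventually.of_forall fun t' =>
          Filter.Eventually.of_forall fun s hcon => hmem hcon.1
  obtain ⟨s, hsZ, hsG, ⟨hsd, hsS, hsc, hsint, -⟩, hs3⟩ : ∃ s, s ∈ Z ∧
      GreedyCover ν (posNbhd W) k l c n (S ∩ posNbhd W s) 1 ∧
      (ν.real (posNbhd W s)ᶜ = d ∧ ν.real (S \ posNbhd W s) = d ∧
      (∀ᵐ u ∂ν, u ∈ S \ posNbhd W s → c u = 0) ∧ ∫ u in S ∩ posNbhd W s, c u ∂ν = r ∧
      ∀ᵐ u ∂ν, u ∈ posNbhd W s → W s u = 1) ∧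
      ∀ᵐ t ∂ν, ∀ᵐ t' ∂ν, ¬ (t ∈ Z ∧ t' ∈ Z ∧ 0 < W t t' ∧ W t s ≤ 0 ∧ W t' s ≤ 0) := by
    have hfreq : ∃ᶠ s in ae ν, s ∈ Z := frequently_ae_mem_iff.2 hZ0
    obtain ⟨s, hs, h1, h2, h3⟩ := (hfreq.and_eventually (hZG.and (hgood.and htriple))).exists
    exact ⟨s, hs, h1 hs, h2 hs, h3⟩
  set P : Set Ω := S \ posNbhd W s with hP
  have hPm : MeasurableSet P := hS.diff (hN s)
  have hSP : S \ P = S ∩ posNbhd W s := by rw [hP, Set.sdiff_sdiff_right_self]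
  have hPZ : ∀ᵐ u ∂ν, u ∈ P → u ∈ Z := hsc.mono fun u hu hmem => ⟨hmem.1, hu hmem⟩
  have hPW : ∀ {u}, u ∈ P → W u s ≤ 0 := fun {u} hu => by
    rw [hsymm]; exact not_lt.1 hu.2
  -- Two adjacent points of P would be adjacent zeros of c with the common non-neighbour s.
  have hzero : ∀ᵐ t ∂ν, t ∈ P → ∀ᵐ t' ∂ν, t' ∈ P → W t t' = 0 := by
    filter_upwards [hs3, hPZ] with t ht htZ hmem
    filter_upwards [ht, hPZ] with t' ht' htZ' hmem'
    by_contra hne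
    exact ht' ⟨htZ hmem, htZ' hmem', lt_of_le_of_ne (hW0 _ _) (Ne.symm hne), hPW hmem, hPW hmem'⟩
  have hone : ∀ᵐ t ∂ν, t ∈ P → ∀ᵐ t' ∂ν, t' ∉ P → W t t' = 1 := by
    filter_upwards [hzero, hPZ, hgood] with t ht htZ htg hmem
    obtain ⟨htd, -, -, -, htone⟩ := htg (htZ hmem)
    -- P is almost contained in the non-neighbourhood of t; both have measure d, so they agree
    -- almost everywhere.
    have hae : P ≤ᵐ[ν] ((posNbhd W t)ᶜ : Set Ω) := by
      filter_upwards [ht hmem] with u hu huP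
      have : W t u = 0 := hu huP
      exact not_lt.2 this.le
    have heq : P =ᵐ[ν] ((posNbhd W t)ᶜ : Set Ω) := by
      refine ae_eq_of_ae_subset_of_measure_ge hae ?_ hPm.nullMeasurableSet (measure_ne_top _ _)
      rw [← ENNReal.toReal_le_toReal (measure_ne_top _ _) (measure_ne_top _ _)]
      exact (htd.trans hsS.symm).le
    filter_upwards [heq.mem_iff, htone] with u hu hu1 huP
    exact hu1 (not_not.1 fun h => huP (hu.2 h))
  refine ⟨P, Set.sdiff_subset, ⟨hPm, hsS, ?_, ?_⟩, ?_, ?_⟩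
  · refine (Measure.ae_prod_iff_ae_ae ?_).2 ?_
    · have : {x : Ω × Ω | x.1 ∈ P → x.2 ∈ P → W x.1 x.2 = 0} =
          ((P ×ˢ P) \ {x | Function.uncurry W x = 0})ᶜ := by
        ext x; simp [Function.uncurry]
      rw [this]
      exact ((hPm.prod hPm).diff (hW (measurableSet_singleton 0))).compl
    · filter_upwards [hzero] with t ht
      by_cases hmem : t ∈ P
      · exact (ht hmem).mono fun u hu _ => hu
      · exact Filter.Eventually.of_forall fun u h => absurd h hmem
  · refine (Measure.ae_prod_iff_ae_ae ?_).2 ?_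
    · have : {x : Ω × Ω | x.1 ∈ P → x.2 ∉ P → W x.1 x.2 = 1} =
          ((P ×ˢ Pᶜ) \ {x | Function.uncurry W x = 1})ᶜ := by
        ext x; simp [Function.uncurry]
      rw [this]
      exact ((hPm.prod hPm.compl).diff (hW (measurableSet_singleton 1))).compl
    · filter_upwards [hone] with t ht
      by_cases hmem : t ∈ P
      · exact (ht hmem).mono fun u hu _ => hu
      · exact Filter.Eventually.of_forall fun u h => absurd h hmem
  · rw [hSP]; exact hsG
  · rw [hSP]; exact hsint

theorem GreedyCover.exists_full_classes (hW : Measurable (Function.uncurry W))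
    (hW0 : ∀ s t, 0 ≤ W s t) (hW1 : ∀ s t, W s t ≤ 1) (hsymm : ∀ s t, W s t = W t s)
    {k l d r : ℝ} (hdeg : ∀ᵐ t ∂ν, 1 - d ≤ ∫ u, W t u ∂ν)
    (hl : 0 < l) (hr : 0 ≤ r) (hrd : r * k < d) (hk : 0 < k) {n : ℕ} {S : Set Ω}
    (hS : MeasurableSet S) {c : Ω → ℝ} (hcm : Measurable c) (hc : Integrable c ν)
    (hc0 : ∀ t, 0 ≤ c t) (h : GreedyCover ν (posNbhd W) k l c n S 1)
    (hint : ∫ t in S, c t ∂ν = r) (hν : ν.real S = n * d + r * l) :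
    ∃ P : Fin n → Set Ω, (∀ i, P i ⊆ S) ∧ (∀ i, IsFullClass ν W d (P i)) ∧
      Pairwise (fun i j => Disjoint (P i) (P j)) ∧ ν.real (S \ ⋃ i, P i) = r * l := by
  induction n generalizing S with
  | zero => exact ⟨fun i => i.elim0, fun i => i.elim0, fun i => i.elim0, fun i => i.elim0, by
      simpa using hν⟩
  | succ n ih =>
    push_cast at hν
    obtain ⟨P, hPS, hP, hG, hI⟩ :=
      h.exists_isFullClass hW hW0 hW1 hsymm hdeg hl hr hrd hk hS hcm hc hc0 hint hν
    have hmeas : ν.real (S \ P) = n * d + r * l := by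
      rw [measureReal_sdiff hPS hP.measurableSet, hP.measureReal_eq, hν]; ring
    obtain ⟨Q, hQS, hQ, hdisj, hrest⟩ := ih (hS.diff hP.measurableSet) hG hI hmeas
    refine ⟨Fin.cons P Q, ?_, ?_, ?_, ?_⟩
    · exact Fin.cases hPS fun i => (hQS i).trans Set.sdiff_subset
    · exact Fin.cases hP hQ
    · have hPQ : ∀ i, Disjoint P (Q i) := fun i => Set.disjoint_left.2 fun u hu hu' => (hQS i hu').2 hu
      intro i j
      refine Fin.cases ?_ (fun i => ?_) i <;> refine Fin.cases ?_ (fun j => ?_) j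
      · exact fun h => absurd rfl h
      · exact fun _ => hPQ j
      · exact fun _ => (hPQ i).symm
      · exact fun h => hdisj fun hij => h (congrArg Fin.succ hij)
    · rw [← hrest]
      congr 1
      ext u
      simp only [Set.mem_sdiff, Set.mem_iUnion, not_exists, Fin.forall_fin_succ, Fin.cons_zero,
        Fin.cons_succ]
      tauto

end Extremal

/-! ### Blowing up cliques along colourings of H -/

section BlowUp

variable {Ω : Type*} [MeasurableSpace Ω] {ν : Measure Ω} [IsProbabilityMeasure ν]

theorem ae_pi_succ_iff {n : ℕ} {p : (Fin (n + 1) → Ω) → Prop} :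
    (∀ᵐ t ∂Measure.pi fun _ : Fin (n + 1) => ν, p t) ↔
      ∀ᵐ z ∂ν.prod (Measure.pi fun _ : Fin n => ν), p (Fin.cons z.1 z.2) := by
  have hmp := measurePreserving_piFinSuccAbove (fun _ : Fin (n + 1) => ν) 0
  constructor
  · intro h
    have := (hmp.symm _).quasiMeasurePreserving.ae h
    filter_upwards [this] with z hz
    simpa [MeasurableEquiv.piFinSuccAbove, Fin.insertNthEquiv] using hz
  · intro h
    have := hmp.quasiMeasurePreserving.ae h
    filter_upwards [this] with t ht
    simpa [MeasurableEquiv.piFinSuccAbove, Fin.insertNthEquiv] using ht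

/-- If almost no tuple indexed by `V` has all its `C`-sections in `A`, then `A` is a null set. -/
theorem ae_notMem_of_ae_not_sections {n : ℕ} {A : Set (Fin n → Ω)} (hA : MeasurableSet A)
    {V : Type*} [Fintype V] (C : V → Fin n)
    (h : ∀ᵐ s ∂Measure.pi fun _ : V => ν, ¬ ∀ σ : Fin n → V, (∀ i, C (σ i) = i) → s ∘ σ ∈ A) :
    ∀ᵐ t ∂Measure.pi fun _ : Fin n => ν, t ∉ A := by
  classical
  induction n generalizing V with
  | zero =>
    obtain ⟨s, hs⟩ := h.exists
    refine Filter.Eventually.of_forall fun t ht => hs fun σ _ => ?_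
    rwa [Subsingleton.elim (s ∘ σ) t]
  | succ n ih =>
    have hcons : Measurable fun z : Ω × (Fin n → Ω) => (Fin.cons z.1 z.2 : Fin (n + 1) → Ω) := by
      refine measurable_pi_lambda _ fun i => ?_
      refine Fin.cases ?_ (fun i => ?_) i
      · simpa using measurable_fst
      · simpa [Function.comp_def] using (measurable_pi_apply i).comp measurable_snd
    set p : V → Prop := fun v => C v = 0
    have hmp := measurePreserving_piEquivPiSubtypeProd (fun _ : V => ν) p
    -- The coordinates over colour 0 are split off and called a. The induction hypothesis is applied
    -- to the tails y that extend every coordinate of a to a point of A.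
    set B : ({v // p v} → Ω) → Set (Fin n → Ω) :=
      fun a => {y | ∀ j, (Fin.cons (a j) y : Fin (n + 1) → Ω) ∈ A} with hB
    have hBm : MeasurableSet {x : ({v // p v} → Ω) × (Fin n → Ω) | x.2 ∈ B x.1} := by
      have : {x : ({v // p v} → Ω) × (Fin n → Ω) | x.2 ∈ B x.1} =
          ⋂ j, {x | (Fin.cons (x.1 j) x.2 : Fin (n + 1) → Ω) ∈ A} := by
        ext x; simp [hB]
      rw [this]
      refine MeasurableSet.iInter fun j => ?_
      have hj : Measurable fun x : ({v // p v} → Ω) × (Fin n → Ω) => (x.1 j, x.2) :=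
        ((measurable_pi_apply j).comp measurable_fst).prodMk measurable_snd
      exact (hcons.comp hj) hA
    have h1 := Measure.ae_ae_of_ae_prod ((hmp.symm _).quasiMeasurePreserving.ae h)
    have h2 : ∀ᵐ a ∂Measure.pi fun _ : {v // p v} => ν, ∀ᵐ y ∂Measure.pi fun _ : Fin n => ν,
        y ∉ B a := by
      filter_upwards [h1] with a ha
      refine ih (A := B a) (measurable_prodMk_left hBm) (V := {v // ¬ p v})
        (fun v => (C v).pred v.2) ?_
      filter_upwards [ha] with b hb hcon
      refine hb fun σ hσ => ?_
      have hσ' : ∀ i : Fin n, ¬ p (σ i.succ) := fun i => by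
        simp only [p, hσ]; exact Fin.succ_ne_zero i
      have := hcon (fun i => ⟨σ i.succ, hσ' i⟩) (fun i => by simp [hσ]) ⟨σ 0, hσ 0⟩
      convert this using 1
      funext i
      refine Fin.cases ?_ (fun i => ?_) i
      · have h0 : p (σ 0) := hσ 0
        simp [MeasurableEquiv.piEquivPiSubtypeProd, Equiv.piEquivPiSubtypeProd, h0]
      · simp [MeasurableEquiv.piEquivPiSubtypeProd, Equiv.piEquivPiSubtypeProd, hσ' i]
    have h3 := (Measure.ae_ae_comm (p := fun a y => y ∉ B a) hBm.compl).1 h2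
    have hm : MeasurableSet {z : Ω × (Fin n → Ω) | (Fin.cons z.1 z.2 : Fin (n + 1) → Ω) ∉ A} :=
      hcons hA.compl
    rw [ae_pi_succ_iff, Measure.ae_prod_iff_ae_ae hm,
      Measure.ae_ae_comm (p := fun a y => (Fin.cons a y : Fin (n + 1) → Ω) ∉ A) hm]
    filter_upwards [h3] with y hy
    -- For fixed y the admissible tuples a form a power of the section of A at y, and a null power
    -- has a null base.
    have hpi : (Measure.pi fun _ : {v // p v} => ν)
        (Set.univ.pi fun _ => {a | (Fin.cons a y : Fin (n + 1) → Ω) ∈ A}) = 0 := by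
      rw [measure_eq_zero_iff_ae_notMem]
      filter_upwards [hy] with a ha hmem
      exact ha fun j => hmem j (Set.mem_univ j)
    rw [Measure.pi_pi, Finset.prod_const] at hpi
    exact measure_eq_zero_iff_ae_notMem.1 (eq_zero_of_pow_eq_zero hpi)

/-- Each level of `GreedyCover` is Fubini applied to the first coordinate. -/
theorem greedyCover_of_ae_pi {N : Ω → Set Ω} {k l : ℝ} {c : Ω → ℝ} {n : ℕ} {S : Set Ω} {β : ℝ}
    (h : ∀ᵐ t ∂Measure.pi fun _ : Fin (n + 1) => ν, (∀ i, t i ∈ S) →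
      (∀ i j, i < j → t j ∈ N (t i)) →
        β ≤ k * ∑ i : Fin n, c (t i.castSucc) + l * c (t (Fin.last n))) :
    GreedyCover ν N k l c n S β := by
  induction n generalizing S β with
  | zero =>
    filter_upwards [Measure.ae_ae_of_ae_prod (ae_pi_succ_iff.1 h)] with t ht htS
    obtain ⟨y, hy⟩ := ht.exists
    simpa using hy (Fin.cases htS fun i => i.elim0)
      (fun i j hij => absurd hij (by have := i.2; have := j.2; omega))
  | succ n ih =>
    filter_upwards [Measure.ae_ae_of_ae_prod (ae_pi_succ_iff.1 h)] with t ht htS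
    refine ih ?_
    filter_upwards [ht] with y hy hyS hyN
    have := hy (Fin.cases htS fun i => (hyS i).1) (fun i j => by
      refine Fin.cases ?_ (fun i => ?_) i <;> refine Fin.cases ?_ (fun j => ?_) j
      · exact fun h => absurd h (lt_irrefl _)
      · exact fun _ => (hyS j).2
      · exact fun h => absurd h (Fin.not_lt_zero _)
      · exact fun h => hyN i j (Fin.succ_lt_succ_iff.1 h))
    rw [Fin.sum_univ_succ] at this
    simp only [Fin.castSucc_zero, Fin.cons_zero, ← Fin.succ_castSucc, Fin.cons_succ,
      ← Fin.succ_last] at this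
    linarith

/-- The section lemma needs a condition on each transversal separately, which a bound on a sum is
not. The bad cliques are therefore covered by countably many sets on which each c(t i) lies below a
rational q i, with the q's summing to at most 1 over V. -/
theorem ae_one_le_sum_of_coloring {V : Type*} [Fintype V] {H : SimpleGraph V} {n : ℕ}
    (C : H.Coloring (Fin n)) (hC : Function.Surjective C) {W : Ω → Ω → ℝ}
    (hW : Measurable (Function.uncurry W)) (hsymm : ∀ s t, W s t = W t s) {c : Ω → ℝ}
    (hc : Measurable c)
    (h : ∀ᵐ s ∂Measure.pi fun _ : V => ν,
      (∀ u v, H.Adj u v → 0 < W (s u) (s v)) → 1 ≤ ∑ v, c (s v)) :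
    ∀ᵐ t ∂Measure.pi fun _ : Fin n => ν, (∀ i j, i < j → 0 < W (t i) (t j)) →
      1 ≤ ∑ v, c (t (C v)) := by
  classical
  obtain ⟨σ₀, hσ₀⟩ := hC.hasRightInverse
  have hq : ∀ q : Fin n → ℚ, (∑ v, (q (C v) : ℝ)) ≤ 1 → ∀ᵐ t ∂Measure.pi fun _ : Fin n => ν,
      ¬ ((∀ i j, i < j → 0 < W (t i) (t j)) ∧ ∀ i, c (t i) < q i) := by
    intro q hq1
    set A : Set (Fin n → Ω) :=
      {t | (∀ i j, i < j → 0 < W (t i) (t j)) ∧ ∀ i, c (t i) < q i} with hA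
    have hAm : MeasurableSet A := by
      have : A = (⋂ i, ⋂ j, ⋂ (_ : i < j), {t | 0 < W (t i) (t j)}) ∩
          ⋂ i, {t | c (t i) < q i} := by
        ext t; simp [hA]
      rw [this]
      refine MeasurableSet.inter ?_ ?_
      · refine MeasurableSet.iInter fun i => MeasurableSet.iInter fun j =>
          MeasurableSet.iInter fun _ => measurableSet_lt measurable_const ?_
        have hij : Measurable fun t : Fin n → Ω => (t i, t j) :=
          (measurable_pi_apply i).prodMk (measurable_pi_apply j)
        exact hW.comp hij
      · exact MeasurableSet.iInter fun i =>
          measurableSet_lt (hc.comp (measurable_pi_apply i)) measurable_const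
    refine ae_notMem_of_ae_not_sections (A := A) hAm C ?_
    filter_upwards [h] with s hs hcon
    have hlt : ∀ v, c (s v) < q (C v) := by
      intro v
      -- Redirecting the reference section σ₀ gives a transversal through any prescribed vertex, and
      -- below through any two of different colours.
      have hsec : ∀ i, C (Function.update σ₀ (C v) v i) = i := by
        intro i
        by_cases hi : i = C v
        · subst hi; simp
        · rw [Function.update_of_ne hi]; exact hσ₀ i
      have := (hcon _ hsec).2 (C v)
      simpa using this
    have hadj : ∀ u v, C u < C v → 0 < W (s u) (s v) := by
      intro u v huv
      have hsec : ∀ i, C (Function.update (Function.update σ₀ (C v) v) (C u) u i) = i := by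
        intro i
        by_cases hi : i = C u
        · subst hi; simp
        · rw [Function.update_of_ne hi]
          by_cases hi' : i = C v
          · subst hi'; simp
          · rw [Function.update_of_ne hi']; exact hσ₀ i
      have := (hcon _ hsec).1 (C u) (C v) huv
      simpa [Function.update_of_ne huv.ne'] using this
    have h1 := hs fun u v huv => by
      rcases lt_or_gt_of_ne (C.valid huv) with hlt | hgt
      · exact hadj u v hlt
      · rw [hsymm]; exact hadj v u hgt
    rcases isEmpty_or_nonempty V with hV | hV
    · simp at h1
      linarith
    · have := Finset.sum_lt_sum_of_nonempty (s := Finset.univ) Finset.univ_nonempty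
        fun v _ => hlt v
      linarith
  filter_upwards [ae_all_iff.2 fun q : Fin n → ℚ => Filter.eventually_imp_distrib_left.2 (hq q)]
    with t ht hclique
  by_contra! hlt
  set δ : ℝ := (1 - ∑ v, c (t (C v))) / (Fintype.card V + 1) with hδ
  have hδ0 : 0 < δ := div_pos (by linarith) (by positivity)
  choose q hq1 hq2 using fun i => exists_rat_btwn (lt_add_of_pos_right (c (t i)) hδ0)
  refine ht q ?_ ⟨hclique, hq1⟩
  have h1 : ∑ v, (q (C v) : ℝ) ≤ ∑ v, (c (t (C v)) + δ) :=
    Finset.sum_le_sum fun v _ => (hq2 (C v)).le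
  rw [Finset.sum_add_distrib, Finset.sum_const, Finset.card_univ, nsmul_eq_mul] at h1
  have h2 : δ * (Fintype.card V + 1) = 1 - ∑ v, c (t (C v)) := by
    rw [hδ]; field_simp
  nlinarith

/-- Averaging the cover inequality over n recolourings equalises the weights of all colours other
than i₀. -/
theorem ae_one_le_weighted_sum {V : Type*} [Fintype V] {H : SimpleGraph V} {n : ℕ} [NeZero n]
    (hsurj : ∀ C : H.Coloring (Fin (n + 1)), Function.Surjective C)
    (C : H.Coloring (Fin (n + 1))) (i₀ : Fin (n + 1)) {W : Ω → Ω → ℝ}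
    (hW : Measurable (Function.uncurry W)) (hsymm : ∀ s t, W s t = W t s) {c : Ω → ℝ}
    (hc : Measurable c)
    (h : ∀ᵐ s ∂Measure.pi fun _ : V => ν,
      (∀ u v, H.Adj u v → 0 < W (s u) (s v)) → 1 ≤ ∑ v, c (s v)) :
    ∀ᵐ t ∂Measure.pi fun _ : Fin (n + 1) => ν, (∀ i j, i < j → 0 < W (t i) (t j)) →
      1 ≤ ((Fintype.card V : ℝ) - (C.colorClass i₀).ncard) / n * ∑ i : Fin n, c (t i.castSucc) +
        (C.colorClass i₀).ncard * c (t (Fin.last n)) := by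
  classical
  set τ : V → Fin (n + 1) := fun v => Equiv.swap i₀ (Fin.last n) (C v) with hτ
  -- The j-th cyclic shift of the first n colours, fixing the last; as j varies, each of the first n
  -- colours visits all n positions once.
  set ρ : Fin n → Fin (n + 1) → Fin (n + 1) := fun j =>
    Fin.lastCases (Fin.last n) fun i => (i + j).castSucc with hρ
  have hρinj : ∀ j, Function.Injective (ρ j) := by
    intro j a b
    refine Fin.lastCases ?_ (fun a => ?_) a <;> refine Fin.lastCases ?_ (fun b => ?_) b
    · exact fun _ => rfl
    · intro h; simp [hρ] at h; exact absurd h.symm (Fin.castSucc_ne_last _)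
    · intro h; simp [hρ] at h
    · intro h; simp [hρ] at h; rw [h]
  have hcol : ∀ j : Fin n, ∀ᵐ t ∂Measure.pi fun _ : Fin (n + 1) => ν,
      (∀ i j, i < j → 0 < W (t i) (t j)) → 1 ≤ ∑ v, c (t (ρ j (τ v))) := fun j =>
    ae_one_le_sum_of_coloring (SimpleGraph.Coloring.mk (fun v => ρ j (τ v)) fun {u v} huv heq =>
      C.valid huv ((Equiv.swap i₀ (Fin.last n)).injective (hρinj j heq))) (hsurj _) hW hsymm hc h
  have hn : (0 : ℝ) < n := Nat.cast_pos.2 (Nat.pos_of_neZero n)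
  have hcard : (C.colorClass i₀).ncard = (Finset.univ.filter fun v => τ v = Fin.last n).card := by
    rw [← Set.ncard_coe_finset]
    congr 1
    ext v
    simp only [Finset.coe_filter, Finset.mem_univ, true_and, hτ]
    change C v = i₀ ↔ Equiv.swap i₀ (Fin.last n) (C v) = Fin.last n
    rw [Equiv.swap_apply_eq_iff, Equiv.swap_apply_right]
  filter_upwards [ae_all_iff.2 hcol] with t ht hclique
  set T : ℝ := ∑ i : Fin n, c (t i.castSucc) with hT
  have hval : ∀ a, ∑ j, c (t (ρ j a)) = if a = Fin.last n then n * c (t (Fin.last n)) else T := by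
    intro a
    refine Fin.lastCases ?_ (fun i => ?_) a
    · simp [hρ]
    · rw [if_neg (Fin.castSucc_ne_last i)]
      simp only [hρ, Fin.lastCases_castSucc]
      exact Equiv.sum_comp (Equiv.addLeft i) fun i' => c (t i'.castSucc)
  have hsum : (n : ℝ) ≤ ∑ j : Fin n, ∑ v, c (t (ρ j (τ v))) := by
    have := Finset.sum_le_sum fun (j : Fin n) (_ : j ∈ Finset.univ) => ht j hclique
    simpa using this
  rw [Finset.sum_comm] at hsum
  simp only [hval] at hsum
  rw [Finset.sum_ite, Finset.sum_const, Finset.sum_const, ← hcard, nsmul_eq_mul, nsmul_eq_mul]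
    at hsum
  have hcompl : (((Finset.univ.filter fun v => ¬ τ v = Fin.last n).card : ℕ) : ℝ) =
      (Fintype.card V : ℝ) - (C.colorClass i₀).ncard := by
    have := Finset.card_filter_add_card_filter_not (s := (Finset.univ : Finset V))
      fun v => τ v = Fin.last n
    rw [← hcard, Finset.card_univ] at this
    rw [← this]; push_cast; ring
  rw [hcompl] at hsum
  have : 1 * (n : ℝ) ≤ (((Fintype.card V : ℝ) - (C.colorClass i₀).ncard) / n * T +
      (C.colorClass i₀).ncard * c (t (Fin.last n))) * n := by
    rw [add_mul, div_mul_eq_mul_div, div_mul_cancel₀ _ hn.ne']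
    linarith
  exact le_of_mul_le_mul_right this hn

end BlowUp

/-! ### Existence of an optimal fractional cover -/

/-- The minimal-norm points of the sets have increasing bounded norms; midpoints stay in the larger
set, so the parallelogram law makes these points Cauchy. This replaces weak compactness. -/
theorem nonempty_iInter_of_closed_convex {F : Type*} [NormedAddCommGroup F] [InnerProductSpace ℝ F]
    [CompleteSpace F] {K : ℕ → Set F} (hK : Antitone K) (hne : ∀ n, (K n).Nonempty)
    (hcl : ∀ n, IsClosed (K n)) (hconv : ∀ n, Convex ℝ (K n)) {R : ℝ}
    (hR : ∀ f ∈ K 0, ‖f‖ ≤ R) : (⋂ n, K n).Nonempty := by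
  have hmin : ∀ n, ∃ p ∈ K n, ∀ f ∈ K n, ‖p‖ ≤ ‖f‖ := by
    intro n
    obtain ⟨p, hp, hpn⟩ :=
      exists_norm_eq_iInf_of_complete_convex (hne n) (hcl n).isComplete (hconv n) 0
    refine ⟨p, hp, fun f hf => ?_⟩
    simp only [zero_sub, norm_neg] at hpn
    rw [hpn]
    exact ciInf_le (f := fun w : K n => ‖(w : F)‖)
      ⟨0, Set.forall_mem_range.2 fun _ => norm_nonneg _⟩ ⟨f, hf⟩
  choose p hpK hpmin using hmin
  have hmono : Monotone fun n => ‖p n‖ ^ 2 := fun n m hnm =>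
    pow_le_pow_left₀ (norm_nonneg _) (hpmin n _ (hK hnm (hpK m))) 2
  have hbdd : BddAbove (Set.range fun n => ‖p n‖ ^ 2) := by
    refine ⟨R ^ 2, Set.forall_mem_range.2 fun n => ?_⟩
    exact pow_le_pow_left₀ (norm_nonneg _) (hR _ (hK (Nat.zero_le n) (hpK n))) 2
  have hlim := tendsto_atTop_ciSup hmono hbdd
  set L := ⨆ n, ‖p n‖ ^ 2 with hL
  have hdist : ∀ n m, n ≤ m → dist (p n) (p m) ≤ Real.sqrt (2 * (L - ‖p n‖ ^ 2)) := by
    intro n m hnm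
    have hmid : (1 / 2 : ℝ) • p n + (1 / 2 : ℝ) • p m ∈ K n :=
      hconv n (hpK n) (hK hnm (hpK m)) (by norm_num) (by norm_num) (by norm_num)
    have h1 := hpmin n _ hmid
    rw [← smul_add, norm_smul] at h1
    norm_num at h1
    have h2 := parallelogram_law_with_norm ℝ (p n) (p m)
    have h3 : ‖p m‖ ^ 2 ≤ L := le_ciSup hbdd m
    have h4 : (2 * ‖p n‖) ^ 2 ≤ ‖p n + p m‖ ^ 2 :=
      pow_le_pow_left₀ (by positivity) (by linarith) 2
    rw [dist_eq_norm]
    refine Real.le_sqrt_of_sq_le ?_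
    nlinarith
  have hb : Filter.Tendsto (fun n => Real.sqrt (2 * (L - ‖p n‖ ^ 2))) Filter.atTop (nhds 0) := by
    have h1 : Filter.Tendsto (fun n => 2 * (L - ‖p n‖ ^ 2)) Filter.atTop (nhds (2 * (L - L))) :=
      (tendsto_const_nhds.sub hlim).const_mul 2
    have h2 := (Real.continuous_sqrt.tendsto _).comp h1
    simpa [Function.comp_def] using h2
  obtain ⟨f, hf⟩ := cauchySeq_tendsto_of_complete (cauchySeq_of_le_tendsto_0' _ hdist hb)
  refine ⟨f, Set.mem_iInter.2 fun n => (hcl n).mem_of_tendsto hf ?_⟩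
  filter_upwards [Filter.eventually_ge_atTop n] with m hm using hK hm (hpK m)

namespace Graphon

variable {Ω : Type*} [MeasurableSpace Ω] {ν : Measure Ω} {V : Type*} [Fintype V]

theorem cover_iff_ae {W : Graphon ν} {F : SimpleGraph V} {c : Ω → ℝ} :
    Measure.pi (fun _ : V => ν) (Function.support (W.tensor F) ∩ {s : V → Ω | ∑ v, c (s v) < 1}) = 0 ↔
      ∀ᵐ s ∂Measure.pi fun _ : V => ν, W.tensor F s ≠ 0 → 1 ≤ ∑ v, c (s v) := by
  rw [measure_eq_zero_iff_ae_notMem]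
  refine Filter.eventually_congr (Filter.Eventually.of_forall fun s => ?_)
  change ¬ (W.tensor F s ≠ 0 ∧ ∑ v, c (s v) < 1) ↔ _
  rw [not_and, not_lt]

theorem fcov_le_integral {W : Graphon ν} {F : SimpleGraph V} {c : Ω → ℝ}
    (hc : W.IsFractionalCover F c) : W.fcov F ≤ ∫ s, c s ∂ν :=
  csInf_le ⟨0, by rintro _ ⟨c, hc, rfl⟩; exact integral_nonneg hc.nonneg⟩ ⟨c, hc, rfl⟩

theorem isFractionalCover_one [Nonempty V] (W : Graphon ν) (F : SimpleGraph V) :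
    W.IsFractionalCover F fun _ => 1 where
  aemeasurable := aemeasurable_const
  nonneg _ := zero_le_one
  le_one _ := le_rfl
  cover := by
    refine (cover_iff_ae (W := W) (F := F) (c := fun _ => 1)).2 (Filter.Eventually.of_forall fun s _ => ?_)
    simpa using Nat.one_le_iff_ne_zero.2 (Fintype.card_ne_zero (α := V))

variable [IsProbabilityMeasure ν]

theorem ae_pi_of_ae {p : Ω → Prop} (h : ∀ᵐ t ∂ν, p t) :
    ∀ᵐ s ∂Measure.pi fun _ : V => ν, ∀ v, p (s v) :=
  ae_all_iff.2 fun v => (measurePreserving_eval (fun _ : V => ν) v).quasiMeasurePreserving.ae h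

/-- The fractional cover number is attained. -/
theorem exists_isFractionalCover_integral_eq_fcov [Nonempty V] (W : Graphon ν)
    (F : SimpleGraph V) : ∃ c, W.IsFractionalCover F c ∧ ∫ s, c s ∂ν = W.fcov F := by
  have hne : {a : ℝ | ∃ c : Ω → ℝ, W.IsFractionalCover F c ∧ a = ∫ s, c s ∂ν}.Nonempty :=
    ⟨_, _, isFractionalCover_one W F, rfl⟩
  set K : ℕ → Set (Lp ℝ 2 ν) := fun n => {f | (∀ᵐ t ∂ν, 0 ≤ f t ∧ f t ≤ 1) ∧
    (∀ᵐ s ∂Measure.pi fun _ : V => ν, W.tensor F s ≠ 0 → 1 ≤ ∑ v, f (s v)) ∧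
    ∫ t, f t ∂ν ≤ W.fcov F + 1 / ((n : ℝ) + 1)} with hK
  have hint : ∀ f : Lp ℝ 2 ν, Integrable f ν := fun f =>
    (Lp.memLp f).integrable one_le_two
  obtain ⟨f, hf⟩ : (⋂ n, K n).Nonempty := by
    refine nonempty_iInter_of_closed_convex ?_ ?_ ?_ ?_
      (R := (measureUnivNNReal ν : ℝ) ^ (2 : ENNReal).toReal⁻¹ * 1) ?_
    · intro n m hnm f hf
      exact ⟨hf.1, hf.2.1, hf.2.2.trans (by linarith [Nat.one_div_le_one_div (α := ℝ) hnm])⟩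
    · intro n
      obtain ⟨_, ⟨c, hc, rfl⟩, hlt⟩ := exists_lt_of_csInf_lt hne
        (lt_add_of_pos_right (W.fcov F) (Nat.one_div_pos_of_nat (n := n) (α := ℝ)))
      have hmem : MemLp c 2 ν := MemLp.of_bound hc.aemeasurable.aestronglyMeasurable 1
        (Filter.Eventually.of_forall fun t => by
          rw [Real.norm_eq_abs, abs_of_nonneg (hc.nonneg t)]; exact hc.le_one t)
      have hae := hmem.coeFn_toLp
      refine ⟨hmem.toLp c, ?_, ?_, ?_⟩
      · filter_upwards [hae] with t ht
        rw [ht]; exact ⟨hc.nonneg t, hc.le_one t⟩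
      · filter_upwards [cover_iff_ae.1 hc.cover, ae_pi_of_ae (V := V) hae] with s hs hs' hW
        simpa only [hs'] using hs hW
      · rw [integral_congr_ae hae]; exact hlt.le
    · intro n
      -- An L²-limit is an almost everywhere limit along a subsequence, which preserves the
      -- pointwise conditions; dominated convergence preserves the bound on the integral.
      refine IsSeqClosed.isClosed fun g f hg hlim => ?_
      obtain ⟨φ, -, hφ⟩ := (tendstoInMeasure_of_tendsto_Lp hlim).exists_seq_tendsto_ae
      have hall : ∀ᵐ t ∂ν, ∀ m, 0 ≤ g (φ m) t ∧ g (φ m) t ≤ 1 :=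
        ae_all_iff.2 fun m => (hg (φ m)).1
      refine ⟨?_, ?_, ?_⟩
      · filter_upwards [hφ, hall] with t ht hb
        exact ⟨ge_of_tendsto' ht fun m => (hb m).1, le_of_tendsto' ht fun m => (hb m).2⟩
      · filter_upwards [ae_pi_of_ae (V := V) hφ, ae_all_iff.2 fun m => (hg (φ m)).2.1]
          with s hs hcov hW
        exact ge_of_tendsto' (tendsto_finsetSum _ fun v _ => hs v) fun m => hcov m hW
      · have := tendsto_integral_of_dominated_convergence (fun _ => (1 : ℝ))
          (fun m => (Lp.aestronglyMeasurable (g (φ m)))) (integrable_const 1)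
          (fun m => ((hg (φ m)).1).mono fun t ht => by
            rw [Real.norm_eq_abs, abs_of_nonneg ht.1]; exact ht.2) hφ
        exact le_of_tendsto' this fun m => (hg (φ m)).2.2
    · intro n f hf g hg a b ha hb hab
      have hae : ∀ᵐ t ∂ν, (a • f + b • g : Lp ℝ 2 ν) t = a * f t + b * g t := by
        filter_upwards [Lp.coeFn_add (a • f) (b • g), Lp.coeFn_smul a f, Lp.coeFn_smul b g]
          with t h1 h2 h3
        rw [h1, Pi.add_apply, h2, h3]; rfl
      refine ⟨?_, ?_, ?_⟩
      · filter_upwards [hae, hf.1, hg.1] with t ht h1 h2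
        rw [ht]
        exact ⟨add_nonneg (mul_nonneg ha h1.1) (mul_nonneg hb h2.1), by nlinarith [h1.2, h2.2]⟩
      · filter_upwards [ae_pi_of_ae (V := V) hae, hf.2.1, hg.2.1] with s hs h1 h2 hW
        simp only [hs, Finset.sum_add_distrib, ← Finset.mul_sum]
        nlinarith [h1 hW, h2 hW]
      · rw [integral_congr_ae hae, integral_add ((hint f).const_mul a) ((hint g).const_mul b),
          integral_const_mul, integral_const_mul]
        have h1 := mul_le_mul_of_nonneg_left hf.2.2 ha
        have h2 := mul_le_mul_of_nonneg_left hg.2.2 hb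
        have h3 : a * (W.fcov F + 1 / ((n : ℝ) + 1)) + b * (W.fcov F + 1 / ((n : ℝ) + 1)) =
            W.fcov F + 1 / ((n : ℝ) + 1) := by rw [← add_mul, hab, one_mul]
        linarith
    · intro f hf
      refine Lp.norm_le_of_ae_bound zero_le_one (hf.1.mono fun t ht => ?_)
      rw [Real.norm_eq_abs, abs_of_nonneg ht.1]; exact ht.2
  rw [Set.mem_iInter] at hf
  have hae : ∀ᵐ t ∂ν, max 0 (min 1 (f t)) = f t := by
    filter_upwards [(hf 0).1] with t ht
    rw [min_eq_right ht.2, max_eq_right ht.1]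
  have hcov : W.IsFractionalCover F fun t => max 0 (min 1 (f t)) := by
    refine ⟨?_, fun t => le_max_left _ _, fun t => max_le zero_le_one (min_le_left _ _), ?_⟩
    · exact aemeasurable_const.max (aemeasurable_const.min (Lp.aestronglyMeasurable f).aemeasurable)
    · refine (cover_iff_ae (W := W) (F := F) (c := fun t => max 0 (min 1 (f t)))).2 ?_
      filter_upwards [ae_pi_of_ae (V := V) hae, (hf 0).2.1] with s hs h hW
      simpa only [hs] using h hW
  refine ⟨_, hcov, le_antisymm ?_ (fcov_le_integral hcov)⟩
  rw [integral_congr_ae hae]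
  refine le_of_forall_pos_le_add fun ε hε => ?_
  obtain ⟨n, hn⟩ := exists_nat_one_div_lt hε
  linarith [(hf n).2.2]

end Graphon

/-! ### From graphons to measurable kernels and clique covers -/

namespace Graphon

variable {Ω : Type*} [MeasurableSpace Ω] {ν : Measure Ω} {V : Type*} [Fintype V]

theorem tensor_ne_zero_iff {W : Graphon ν} {F : SimpleGraph V} {s : V → Ω} :
    W.tensor F s ≠ 0 ↔ ∀ u v, F.Adj u v → W (s u) (s v) ≠ 0 := by
  classical
  rw [tensor, Finset.prod_ne_zero_iff]
  constructor
  · intro h u v huv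
    simpa using h s(u, v) (by simpa using huv)
  · intro h e
    induction e using Sym2.ind with
    | _ u v =>
      intro he
      simpa using h u v (by simpa using he)

/-- A measurable modification need not be symmetric or take values in [0,1]; the maximum with its
transpose and truncation restore both, changing only null sets. -/
theorem exists_measurable_representative [SFinite ν] (W : Graphon ν) :
    ∃ W' : Ω → Ω → ℝ, Measurable (Function.uncurry W') ∧ (∀ s t, 0 ≤ W' s t) ∧
      (∀ s t, W' s t ≤ 1) ∧ (∀ s t, W' s t = W' t s) ∧
      ∀ᵐ p ∂ν.prod ν, W p.1 p.2 = W' p.1 p.2 := by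
  set g := W.aemeasurable'.mk
  have hg : Measurable g := W.aemeasurable'.measurable_mk
  have hgae : ∀ᵐ p ∂ν.prod ν, W p.1 p.2 = g p := W.aemeasurable'.ae_eq_mk
  refine ⟨fun s t => max 0 (min 1 (max (g (s, t)) (g (t, s)))), ?_, fun s t => le_max_left _ _,
    fun s t => max_le zero_le_one (min_le_left _ _), 
    fun s t => congrArg (fun y => max 0 (min 1 y)) (max_comm _ _), ?_⟩
  · exact measurable_const.max (measurable_const.min (hg.max (hg.comp measurable_swap)))
  · filter_upwards [hgae, Measure.measurePreserving_swap.quasiMeasurePreserving.ae hgae] with p h1 h2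
    have h3 : g (p.2, p.1) = W p.1 p.2 := by
      rw [W.symm' p.1 p.2]; exact h2.symm
    change _ = max 0 (min 1 (max (g p) (g (p.2, p.1))))
    rw [h3, ← h1, max_self, min_eq_right (W.le_one' _ _), max_eq_right (W.nonneg' _ _)]

theorem ae_minDegree_le (W : Graphon ν) : ∀ᵐ t ∂ν, W.minDegree ≤ W.degree t :=
  ae_essInf_le ⟨0, Filter.eventually_map.2 (Filter.Eventually.of_forall fun t =>
    integral_nonneg fun u => W.nonneg' t u)⟩

variable [IsProbabilityMeasure ν]

theorem ae_pi_of_ae_prod {p : Ω × Ω → Prop} (h : ∀ᵐ q ∂ν.prod ν, p q) {u v : V} (huv : u ≠ v) :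
    ∀ᵐ s ∂Measure.pi fun _ : V => ν, p (s u, s v) := by
  have hi : ProbabilityTheory.iIndepFun (fun (w : V) (s : V → Ω) => s w)
      (Measure.pi fun _ : V => ν) :=
    ProbabilityTheory.iIndepFun_pi (X := fun (_ : V) (t : Ω) => t) fun _ => aemeasurable_id
  have hmap := (hi.indepFun huv).map_prod_eq_prod_map_map (measurable_pi_apply u).aemeasurable
    (measurable_pi_apply v).aemeasurable
  rw [(measurePreserving_eval (fun _ : V => ν) u).map_eq,
    (measurePreserving_eval (fun _ : V => ν) v).map_eq] at hmap
  have hq : Measure.QuasiMeasurePreserving (fun s : V → Ω => (s u, s v))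
      (Measure.pi fun _ : V => ν) (ν.prod ν) :=
    ⟨(measurable_pi_apply u).prodMk (measurable_pi_apply v), hmap.le.absolutelyContinuous⟩
  exact hq.ae h

/-- A fractional cover of `W` yields, almost surely, a weighted cover of the cliques of `W`. -/
theorem IsFractionalCover.greedyCover {W : Graphon ν} {H : SimpleGraph V} {n : ℕ} [NeZero n]
    (hsurj : ∀ C : H.Coloring (Fin (n + 1)), Function.Surjective C)
    (C : H.Coloring (Fin (n + 1))) (i₀ : Fin (n + 1)) {c : Ω → ℝ}
    (hc : W.IsFractionalCover H c) {W' : Ω → Ω → ℝ} (hW' : Measurable (Function.uncurry W'))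
    (hsymm : ∀ s t, W' s t = W' t s) (hWW' : ∀ᵐ p ∂ν.prod ν, W p.1 p.2 = W' p.1 p.2)
    {c' : Ω → ℝ} (hcm : Measurable c') (hcc' : ∀ᵐ t ∂ν, c t = c' t) :
    GreedyCover ν (posNbhd W') (((Fintype.card V : ℝ) - (C.colorClass i₀).ncard) / n)
      (C.colorClass i₀).ncard c' n Set.univ 1 := by
  refine greedyCover_of_ae_pi ?_
  refine (ae_one_le_weighted_sum hsurj C i₀ hW' hsymm hcm ?_).mono fun t ht _ hN => ht hN
  have hall : ∀ᵐ s ∂Measure.pi fun _ : V => ν, ∀ u v, H.Adj u v →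
      W (s u) (s v) = W' (s u) (s v) := by
    refine ae_all_iff.2 fun u => ae_all_iff.2 fun v => ?_
    refine Filter.eventually_imp_distrib_left.2 fun huv => ae_pi_of_ae_prod hWW' huv.ne
  filter_upwards [hall, ae_pi_of_ae (V := V) hcc', cover_iff_ae.1 hc.cover] with s hs hsc hcov hpos
  simp only [← hsc]
  refine hcov (tensor_ne_zero_iff.2 fun u v huv => ?_)
  rw [hs u v huv]
  exact (hpos u v huv).ne'

end Graphon

/-! ### Smallest colour classes -/

section ChromaticNumber

variable {V : Type*} [Fintype V] {H : SimpleGraph V}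

theorem chromaticNumber_eq_finChromaticNumber :
    H.chromaticNumber = (finChromaticNumber H : ℕ∞) :=
  (ENat.natCast_toNat (SimpleGraph.chromaticNumber_ne_top_iff_exists.2
    ⟨_, SimpleGraph.colorable_of_fintype H⟩)).symm

theorem colorable_finChromaticNumber : H.Colorable (finChromaticNumber H) :=
  SimpleGraph.chromaticNumber_le_iff_colorable.1 chromaticNumber_eq_finChromaticNumber.le

/-- A colouring with χ(H) colours has no empty class, whence ℓ > 0; summing the class sizes gives
χ(H) ℓ ≤ h. -/
theorem exists_smallestColorClass {r : ℕ} (hr : finChromaticNumber H = r) (hr0 : 0 < r) :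
    (∀ C : H.Coloring (Fin r), Function.Surjective C) ∧
    ∃ (C : H.Coloring (Fin r)) (i : Fin r), smallestColorClass H = (C.colorClass i).ncard ∧
      0 < smallestColorClass H ∧ r * smallestColorClass H ≤ Fintype.card V := by
  classical
  subst hr
  have hsurj : ∀ C : H.Coloring (Fin (finChromaticNumber H)), Function.Surjective C :=
    SimpleGraph.le_chromaticNumber_iff_forall_surjective.1
      chromaticNumber_eq_finChromaticNumber.ge
  obtain ⟨C₀⟩ : Nonempty (H.Coloring (Fin (finChromaticNumber H))) := colorable_finChromaticNumber
  obtain ⟨C, i, hCi⟩ := Nat.sInf_mem (s := {m : ℕ | ∃ (C : H.Coloring (Fin (finChromaticNumber H)))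
    (i : Fin (finChromaticNumber H)), m = (C.colorClass i).ncard}) ⟨_, C₀, ⟨0, hr0⟩, rfl⟩
  change smallestColorClass H = _ at hCi
  refine ⟨hsurj, C, i, hCi, ?_, ?_⟩
  · rw [hCi, Set.ncard_pos (Set.toFinite _)]
    obtain ⟨v, hv⟩ := hsurj C i
    exact ⟨v, hv⟩
  · have hle : ∀ j, smallestColorClass H ≤ (Finset.univ.filter fun v => C v = j).card := by
      intro j
      refine Nat.sInf_le ⟨C, j, ?_⟩
      rw [← Set.ncard_coe_finset]
      congr 1
      ext v
      simp [SimpleGraph.Coloring.colorClass]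
    have hsum := Finset.card_eq_sum_card_fiberwise (s := (Finset.univ : Finset V))
      (t := Finset.univ) (f := fun v => C v) fun v _ => Finset.mem_coe.2 (Finset.mem_univ _)
    rw [← Finset.card_univ, hsum]
    have := Finset.card_nsmul_le_sum Finset.univ
      (fun j => (Finset.univ.filter fun v => C v = j).card) (smallestColorClass H)
      fun j _ => hle j
    simpa using this

end ChromaticNumber

/-! ### Constants and assembly of the theorem -/

theorem theorem4p3 {Ω : Type*} [MeasurableSpace Ω] [StandardBorelSpace Ω]
    (ν : MeasureTheory.Measure Ω) [MeasureTheory.IsProbabilityMeasure ν]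
    [MeasureTheory.NullSingletonClass ν]
    {V : Type*} [Fintype V] (H : SimpleGraph V) (hH : 2 ≤ finChromaticNumber H)
    (x : ℝ) (hx0 : 0 ≤ x) (hx1 : x ≤ 1) (W : Graphon ν)
    (hW : x * (1 - 1 / criticalChromaticNumber H)
        + (1 - x) * (1 - 1 / ((finChromaticNumber H : ℝ) - 1)) ≤ W.minDegree) :
    (∀ c : Ω → ℝ, W.IsFractionalCover H c → x / (Fintype.card V : ℝ) ≤ ∫ s, c s ∂ν) ∧
    x / (Fintype.card V : ℝ) ≤ W.fcov H ∧
    (x < 1 → W.fcov H = x / (Fintype.card V : ℝ) →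
      W.IsBottleneck x (criticalChromaticNumber H)) := by
  obtain ⟨n, hn⟩ : ∃ n, finChromaticNumber H = n + 1 := ⟨finChromaticNumber H - 1, by omega⟩
  have hn1 : 1 ≤ n := by omega
  have : NeZero n := ⟨by omega⟩
  obtain ⟨hsurj, C, i₀, hl, hl0, hlh⟩ := exists_smallestColorClass hn (by omega)
  set h : ℝ := (Fintype.card V : ℝ) with hh
  set l : ℝ := (smallestColorClass H : ℝ) with hl'
  set χ := criticalChromaticNumber H with hχ
  have hnR : (1 : ℝ) ≤ n := by exact_mod_cast hn1
  have hlR : 0 < l := by rw [hl']; exact_mod_cast hl0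
  have hlhR : ((n : ℝ) + 1) * l ≤ h := by rw [hl', hh]; exact_mod_cast hlh
  have hhl : 0 < h - l := by nlinarith
  have hh0 : 0 < h := by linarith
  have hχeq : χ = n * h / (h - l) := by
    rw [hχ, criticalChromaticNumber, hn]; push_cast; ring
  have hχ0 : 0 < χ := by rw [hχeq]; positivity
  -- ℓ > 0 gives n < χ_cr, and (n + 1) ℓ ≤ h gives χ_cr ≤ n + 1; so ⌈χ_cr⌉ = χ(H), the number of
  -- classes.
  have hχn : (n : ℝ) < χ := by
    rw [hχeq, lt_div_iff₀ hhl]; nlinarith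
  have hχn1 : χ ≤ n + 1 := by
    rw [hχeq, div_le_iff₀ hhl]; nlinarith
  have hceil : ⌈χ⌉₊ = n + 1 := by
    rw [Nat.ceil_eq_iff (by omega)]
    push_cast
    exact ⟨by simpa using hχn, hχn1⟩
  set k : ℝ := (h - l) / n with hk
  have hk0 : 0 < k := by positivity
  set d : ℝ := x / χ + (1 - x) / n with hd
  set r : ℝ := x / h with hr
  have hr0 : 0 ≤ r := by positivity
  have hrk : r * k = x / χ := by
    rw [hr, hk, hχeq]; field_simp
  have hrl : r * l = x * (χ + 1 - (n + 1)) / χ := by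
    rw [hr, hχeq]; field_simp; ring
  have hrd : r * k ≤ d := by
    rw [hrk, hd]
    have : 0 ≤ (1 - x) / n := div_nonneg (by linarith) (by positivity)
    linarith
  have htotal : n * d + r * l = 1 := by
    rw [hrl, hd]; field_simp; ring
  obtain ⟨W', hWm, hW0, hW1, hWs, hWae⟩ := W.exists_measurable_representative
  have hdeg : ∀ᵐ t ∂ν, 1 - d ≤ ∫ u, W' t u ∂ν := by
    filter_upwards [W.ae_minDegree_le, Measure.ae_ae_of_ae_prod hWae] with t ht1 ht2
    have h1 : W.degree t = ∫ u, W' t u ∂ν := integral_congr_ae ht2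
    rw [← h1]
    refine le_trans (le_of_eq ?_) (hW.trans ht1)
    rw [hn, hd]; push_cast; ring
  have hdc : ∀ᵐ t ∂ν, ν.real (posNbhd W' t)ᶜ ≤ d :=
    hdeg.mono fun t ht => measureReal_compl_posNbhd_le hWm hW0 hW1 ht
  have hrep : ∀ c : Ω → ℝ, W.IsFractionalCover H c → ∃ c' : Ω → ℝ, Measurable c' ∧
      Integrable c' ν ∧ (∀ t, 0 ≤ c' t) ∧ ∫ t, c' t ∂ν = ∫ t, c t ∂ν ∧
      GreedyCover ν (posNbhd W') k l c' n Set.univ 1 := by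
    intro c hc
    set c' : Ω → ℝ := fun t => max 0 (min 1 (hc.aemeasurable.mk c t)) with hc'
    have hm : Measurable c' :=
      measurable_const.max (measurable_const.min hc.aemeasurable.measurable_mk)
    have hae : ∀ᵐ t ∂ν, c t = c' t := by
      filter_upwards [hc.aemeasurable.ae_eq_mk] with t ht
      simp only [hc']
      rw [← ht, min_eq_right (hc.le_one t), max_eq_right (hc.nonneg t)]
    have hG := hc.greedyCover hsurj C i₀ hWm hWs hWae hm hae
    rw [← hl] at hG
    exact ⟨c', hm, integrable_of_mem_unit hm (fun t => le_max_left _ _)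
      (fun t => max_le zero_le_one (min_le_left _ _)), fun t => le_max_left _ _,
      (integral_congr_ae hae).symm, hG⟩
  have hlower : ∀ c : Ω → ℝ, W.IsFractionalCover H c → r ≤ ∫ s, c s ∂ν := by
    intro c hc
    obtain ⟨c', -, hci, hc0, hint, hG⟩ := hrep c hc
    have := hG.le_setIntegral (measurableSet_posNbhd hWm) hdc hlR hr0 hrd hk0.le MeasurableSet.univ
      hci (Filter.Eventually.of_forall fun t _ => hc0 t) (by rw [htotal, probReal_univ])
    rwa [mul_one, setIntegral_univ, hint] at this
  have : Nonempty V := Fintype.card_pos_iff.1 (by rw [hh] at hh0; exact_mod_cast hh0)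
  obtain ⟨c, hc, hcint⟩ := W.exists_isFractionalCover_integral_eq_fcov H
  refine ⟨hlower, hcint ▸ hlower c hc, fun hx hfcov => ?_⟩
  have hrd' : r * k < d := by
    rw [hrk, hd]
    have : 0 < (1 - x) / n := div_pos (by linarith) (by positivity)
    linarith
  obtain ⟨c', hcm, hci, hc0, hint, hG⟩ := hrep c hc
  obtain ⟨P, -, hP, hdisj, hrest⟩ := hG.exists_full_classes hWm hW0 hW1 hWs hdeg hlR hr0 hrd' hk0
    MeasurableSet.univ hcm hci hc0 (by rw [setIntegral_univ, hint, hcint, hfcov])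
    (by rw [htotal, probReal_univ])
  have hχd : (χ - x * (χ + 1 - (n + 1))) / (χ * ((n + 1 : ℝ) - 1)) = d := by
    rw [hd, add_sub_cancel_right]; field_simp; ring
  -- Indexing by ℕ avoids transport between `Fin ⌈χ⌉₊` and `Fin (n + 1)`; index n receives the
  -- remainder.
  set Q : ℕ → Set Ω := fun i => if hi : i < n then P ⟨i, hi⟩ else Set.univ \ ⋃ i, P i with hQ
  have hQlt : ∀ {i} (hi : i < n), Q i = P ⟨i, hi⟩ := fun hi => dif_pos hi
  have hQge : ∀ {i}, ¬ i < n → Q i = Set.univ \ ⋃ i, P i := fun hi => dif_neg hi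
  have hQdisj : ∀ i j, i < j → j < n + 1 → Disjoint (Q i) (Q j) := by
    intro i j hij hj
    have hi : i < n := by omega
    by_cases hjn : j < n
    · rw [hQlt hi, hQlt hjn]
      exact hdisj fun h => hij.ne (congrArg Fin.val h)
    · rw [hQlt hi, hQge hjn]
      exact Set.disjoint_left.2 fun u hu hu' => hu'.2 (Set.mem_iUnion.2 ⟨_, hu⟩)
  refine ⟨fun i => Q i, fun i => ?_, ?_, ?_, fun i hi => ?_, fun i hi => ?_, fun i j hij => ?_,
    fun i hi => ?_⟩
  · by_cases hin : (i : ℕ) < n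
    · simp only [hQlt hin]
      exact (hP _).measurableSet
    · simp only [hQge hin]
      exact MeasurableSet.univ.diff (MeasurableSet.iUnion fun i => (hP i).measurableSet)
  · intro i j hij
    have hi := i.2
    have hj := j.2
    rcases lt_or_gt_of_ne (Fin.val_ne_of_ne hij) with h | h
    · exact hQdisj _ _ h (by omega)
    · exact (hQdisj _ _ h (by omega)).symm
  · refine Set.eq_univ_of_forall fun u => Set.mem_iUnion.2 ?_
    by_cases hu : ∃ i, u ∈ P i
    · obtain ⟨i, hi⟩ := hu
      refine ⟨⟨i, by omega⟩, ?_⟩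
      change u ∈ Q i
      rwa [hQlt i.2]
    · refine ⟨⟨n, by omega⟩, ?_⟩
      change u ∈ Q n
      rw [hQge (lt_irrefl n)]
      exact ⟨Set.mem_univ u, fun hmem => hu (Set.mem_iUnion.1 hmem)⟩
  · have hin : ¬ (i : ℕ) < n := by omega
    simp only [hQge hin]
    rw [hrest, hrl, hceil]; push_cast; ring
  · have hin : (i : ℕ) < n := by omega
    simp only [hQlt hin]
    rw [(hP _).measureReal_eq, ← hχd, hceil]; push_cast; ring
  · have hj := j.2
    have hlt : (i : ℕ) < j := hij
    -- The smaller index never belongs to the remainder, so the full class at i also settles the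
    -- case where j does.
    have hin : (i : ℕ) < n := by omega
    have hd := hQdisj i j hlt (by omega)
    rw [hQlt hin] at hd
    simp only [hQlt hin]
    filter_upwards [hWae, (hP ⟨i, hin⟩).ae_one] with p hp h1 hp1 hp2
    rw [hp]
    exact h1 hp1 fun hmem => Set.disjoint_left.1 hd hmem hp2
  · have hin : (i : ℕ) < n := by omega
    simp only [hQlt hin]
    filter_upwards [hWae, (hP ⟨i, hin⟩).ae_zero] with p hp h1 hp1 hp2
    rw [hp]
    exact h1 hp1 hp2
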